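/- **Setting.** Let $X=\mathrm{SL}_3(\mathbb R)/\mathrm{SL}_3(\mathbb Z)$ be the space of unimodular lattices in $\mathbb R^3$, let $A\le \mathrm{SL}_3(\mathbb R)$ be the group of diagonal matrices with positive entries, and let $\mathbb R^3_0=\{x\in\mathbb R^3: x_1+x_2+x_3=0\}$. The height of a lattice $L$ is $\mathrm{ht}(L)=(\min\{\|v\| : 0\ne v\in L\})^{-1}$, with $\|\cdot\|$ the Euclidean norm. For a sequence $\mu_i$ of $A$-invariant probability measures on $X$, each supported on a single $A$-orbit $Ax_i$, and for $0<c\le1$, we say that the sequence (of orbits) exhibits *$c$-escape of mass* if every weak-$*$ accumulation point $\mu$ of $(\mu_i)$ (a locally finite Borel measure on $X$, tested against continuous functions with compact support) satisfies $\mu(X)\le 1-c$. Let $K$ be a totally real cubic number field with real embeddings $\sigma_1,\sigma_2,\sigma_3$ (in some order), and set $\varphi(\alpha)=(\sigma_i(\alpha))_{i}$ and $\psi(\alpha)=(\log|\sigma_i(\alpha)|)_{i}$. A *full module* in $K$ is a subgroup $M=\mathbb Z\alpha_1+\mathbb Z\alpha_2+\mathbb Z\alpha_3$ with $\mathbb QM=K$.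 Its *associated order* is $\mathcal O_M=\{\alpha\in K:\alpha M\subseteq M\}$, its discriminant $D_M$ is the square of the covolume of $\varphi(M)$, and $L_M=D_M^{-1/6}\varphi(M)\in X$. A *simplex set* is a set $\Phi=\{\alpha_1,\alpha_2,\alpha_3\}\subset\mathbb R^3_0$ that spans $\mathbb R^3_0$ over $\mathbb R$ and satisfies $\alpha_1+\alpha_2+\alpha_3=0$. Put $W_\Phi=\{\sum_j\lambda_j\alpha_j : \{\lambda_1,\lambda_2,\lambda_3\}=\{0,\tfrac13,\tfrac23\}\}$, and let $\lceil W_\Phi\rceil$ be the largest coordinate of a vector of $W_\Phi$. A simplex set $\Phi\subset\psi(\mathcal O_M^\times)$ is *$(R,r)$-tight* if $\exp(r\lceil W_\Phi\rceil)\le R\cdot \mathrm{ht}(L_M)$. **Theorem.** Let $R>0$ and $0<r\le 1$ be fixed. Let $K_i$ $(i\in\mathbb N)$ be totally real cubic number fields, all contained in a common field of characteristic zero, and let $M_i\subset K_i$ be full modules whose associated orders $\mathcal O_i=\mathcal O_{M_i}$ are pairwise distinct. Suppose that for each $i$ there is a simplex set $\Phi_i\subset\psi(\mathcal O_i^\times)$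 which is $(R,r)$-tight. Then the orbits $AL_{M_i}$ are periodic, i.e. each of them supports a unique $A$-invariant Borel probability measure $\mu_{AL_{M_i}}$ on $X$, and the sequence of periodic orbits $AL_{M_i}$ exhibits $r^2$-escape of mass. -/

import Mathlib

open MeasureTheory Filter Topology
open scoped Pointwise CompactlySupported MatrixGroups

namespace CubicOrbit

noncomputable section

/-! ### The space of unimodular lattices in `ℝ³` -/

/-- The subgroup `SL₃(ℤ)` of `SL₃(ℝ)`. -/
abbrev integerPoints : Subgroup SL(3, ℝ) :=
  (Matrix.SpecialLinearGroup.map (n := Fin 3) (Int.castRingHom ℝ)).range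

/-- The space `X = SL₃(ℝ) / SL₃(ℤ)` with the quotient topology. -/
abbrev LatticeSpace : Type := SL(3, ℝ) ⧸ integerPoints

/-- `X` carries its Borel `σ`-algebra. -/
instance : MeasurableSpace LatticeSpace := borel LatticeSpace

instance : BorelSpace LatticeSpace := ⟨rfl⟩

/-- The standard lattice `ℤ³ ⊆ ℝ³`. -/
def stdLattice : Submodule ℤ (Fin 3 → ℝ) :=
  Submodule.span ℤ (Set.range (Pi.basisFun ℝ (Fin 3)))

/-- The linear automorphism `v ↦ g v` of `ℝ³`, viewed as a `ℤ`-linear map. -/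
def actMap (g : SL(3, ℝ)) : (Fin 3 → ℝ) →ₗ[ℤ] (Fin 3 → ℝ) :=
  (Matrix.toLin' (g : Matrix (Fin 3) (Fin 3) ℝ)).restrictScalars ℤ

lemma actMap_mul (g h : SL(3, ℝ)) : actMap (g * h) = (actMap g).comp (actMap h) := by
  ext v
  simp [actMap]

lemma mem_stdLattice (v : Fin 3 → ℝ) : v ∈ stdLattice ↔ ∀ i, ∃ n : ℤ, (n : ℝ) = v i := by
  rw [stdLattice, Module.Basis.mem_span_iff_repr_mem]
  simp

lemma actMap_map_le (γ : SL(3, ℤ)) :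
    stdLattice.map (actMap (Matrix.SpecialLinearGroup.map (Int.castRingHom ℝ) γ)) ≤
      stdLattice := by
  rintro _ ⟨v, hv, rfl⟩
  rw [SetLike.mem_coe, mem_stdLattice] at hv
  rw [mem_stdLattice]
  intro i
  choose n hn using hv
  refine ⟨∑ j, (γ : Matrix (Fin 3) (Fin 3) ℤ) i j * n j, ?_⟩
  simp [actMap, Matrix.mulVec, dotProduct, hn]

lemma actMap_map_eq (γ : SL(3, ℤ)) :
    stdLattice.map (actMap (Matrix.SpecialLinearGroup.map (Int.castRingHom ℝ) γ)) =
      stdLattice := by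
  refine le_antisymm (actMap_map_le γ) ?_
  have h := Submodule.map_mono
    (f := actMap (Matrix.SpecialLinearGroup.map (Int.castRingHom ℝ) γ)) (actMap_map_le γ⁻¹)
  rw [← Submodule.map_comp, ← actMap_mul, ← map_mul, mul_inv_cancel, map_one] at h
  have h1 : actMap (1 : SL(3, ℝ)) = LinearMap.id := by
    ext v
    simp [actMap]
  rwa [h1, Submodule.map_id] at h

/-- The lattice `g ℤ³` represented by the point `g SL₃(ℤ)` of `X`. -/
def toLattice (x : LatticeSpace) : Submodule ℤ (Fin 3 → ℝ) :=
  Quotient.liftOn' x (fun g => stdLattice.map (actMap g)) (by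
    intro g h hgh
    obtain ⟨γ, hγ⟩ := QuotientGroup.leftRel_apply.1 hgh
    have hh : h = g * Matrix.SpecialLinearGroup.map (Int.castRingHom ℝ) γ := by
      rw [hγ]; group
    change stdLattice.map (actMap g) = stdLattice.map (actMap h)
    rw [hh, actMap_mul, Submodule.map_comp, actMap_map_eq])

lemma toLattice_mk (g : SL(3, ℝ)) :
    toLattice (QuotientGroup.mk g) = stdLattice.map (actMap g) := rfl

/-- A point of `X` is determined by its lattice. -/
lemma toLattice_injective : Function.Injective toLattice := by
  intro x y
  induction x using QuotientGroup.induction_on with | _ g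
  induction y using QuotientGroup.induction_on with | _ h
  intro e
  rw [toLattice_mk, toLattice_mk] at e
  have hk : stdLattice.map (actMap (g⁻¹ * h)) = stdLattice := by
    have h1 : actMap (1 : SL(3, ℝ)) = LinearMap.id := by
      ext v
      simp [actMap]
    rw [actMap_mul, Submodule.map_comp, ← e, ← Submodule.map_comp, ← actMap_mul,
      inv_mul_cancel, h1, Submodule.map_id]
  have hent : ∀ i j, ∃ n : ℤ, (n : ℝ) = ((g⁻¹ * h : SL(3, ℝ)) : Matrix (Fin 3) (Fin 3) ℝ) i j := by
    intro i j
    have hj : actMap (g⁻¹ * h) (Pi.basisFun ℝ (Fin 3) j) ∈ stdLattice := by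
      rw [← hk]
      exact Submodule.mem_map_of_mem (Submodule.subset_span ⟨j, rfl⟩)
    obtain ⟨n, hn⟩ := (mem_stdLattice _).1 hj i
    refine ⟨n, hn.trans ?_⟩
    simp only [actMap, LinearMap.coe_restrictScalars, Matrix.toLin'_apply, Pi.basisFun_apply,
      Matrix.mulVec_single_one, Matrix.col_apply]
  choose N hN using hent
  have hmap : (Matrix.of N).map (Int.castRingHom ℝ) =
      ((g⁻¹ * h : SL(3, ℝ)) : Matrix (Fin 3) (Fin 3) ℝ) := by
    ext i j
    simpa using hN i j
  have hdet : (Matrix.of N).det = 1 := by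
    have := congrArg Matrix.det hmap
    rw [Matrix.SpecialLinearGroup.det_coe, ← RingHom.mapMatrix_apply, ← RingHom.map_det, eq_intCast] at this
    exact_mod_cast this
  refine QuotientGroup.eq.2 ⟨⟨Matrix.of N, hdet⟩, ?_⟩
  apply Subtype.ext
  exact hmap

/-- The height of a lattice: the inverse of the least Euclidean norm of a nonzero vector. -/
def height (L : Submodule ℤ (Fin 3 → ℝ)) : ℝ :=
  (sInf {t : ℝ | ∃ v ∈ L, v ≠ 0 ∧ t = ‖WithLp.toLp 2 v‖})⁻¹

/-- The group `A` of diagonal matrices with positive entries in `SL₃(ℝ)`. -/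
def posDiag : Subgroup SL(3, ℝ) where
  carrier := {g | ∃ d : Fin 3 → ℝ, (∀ i, 0 < d i) ∧
    (g : Matrix (Fin 3) (Fin 3) ℝ) = Matrix.diagonal d}
  one_mem' := ⟨fun _ => 1, fun _ => one_pos, by simp⟩
  mul_mem' := by
    rintro a b ⟨d, hd, had⟩ ⟨e, he, hbe⟩
    exact ⟨fun i => d i * e i, fun i => mul_pos (hd i) (he i), by
      rw [Matrix.SpecialLinearGroup.coe_mul, had, hbe, Matrix.diagonal_mul_diagonal]⟩
  inv_mem' := by
    rintro a ⟨d, hd, had⟩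
    refine ⟨fun i => (d i)⁻¹, fun i => inv_pos.2 (hd i), ?_⟩
    have h1 : (a : Matrix (Fin 3) (Fin 3) ℝ) * Matrix.diagonal (fun i => (d i)⁻¹) = 1 := by
      rw [had, Matrix.diagonal_mul_diagonal, ← Matrix.diagonal_one]
      congr 1
      funext i
      exact mul_inv_cancel₀ (hd i).ne'
    have h2 : ((a⁻¹ : SL(3, ℝ)) : Matrix (Fin 3) (Fin 3) ℝ) * (a : Matrix (Fin 3) (Fin 3) ℝ) = 1 := by
      rw [← Matrix.SpecialLinearGroup.coe_mul, inv_mul_cancel, Matrix.SpecialLinearGroup.coe_one]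
    exact left_inv_eq_right_inv h2 h1

/-! ### Periodic orbits and escape of mass -/

/-- `μ` is the periodic measure of the orbit `A x`: an `A`-invariant Borel probability measure
on `X` that is supported on `A x`. -/
structure IsPeriodicMeasure (x : LatticeSpace) (μ : Measure LatticeSpace) : Prop where
  isProbabilityMeasure : IsProbabilityMeasure μ
  invariant : SMulInvariantMeasure posDiag LatticeSpace μ
  supported : μ (MulAction.orbit posDiag x)ᶜ = 0

/-- The positive functional `f ↦ ∫ f dμ` on `C_c(X)`, as a point of the product `ℝ ^ C_c(X)`,
whose topology is that of pointwise convergence on `C_c(X)` (the weak-* topology). -/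
def toFunctional (μ : Measure LatticeSpace) : C_c(LatticeSpace, ℝ) → ℝ :=
  fun f => ∫ x, f x ∂μ

/-- The locally finite Borel measure `μ` on `X` is a weak-* accumulation point of the
sequence `ν`. -/
structure IsWeakStarAccPt (ν : ℕ → Measure LatticeSpace) (μ : Measure LatticeSpace) : Prop where
  locallyFinite : IsLocallyFiniteMeasure μ
  mapClusterPt : MapClusterPt (toFunctional μ) atTop (fun n => toFunctional (ν n))

/-- The sequence `ν` exhibits `c`-escape of mass: every weak-* accumulation point `μ` of `ν`
satisfies `μ(X) ≤ 1 - c`. -/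
def EscapeOfMass (c : ℝ) (ν : ℕ → Measure LatticeSpace) : Prop :=
  ∀ μ : Measure LatticeSpace, IsWeakStarAccPt ν μ → μ Set.univ ≤ ENNReal.ofReal (1 - c)

/-! ### Full modules in totally real cubic fields

The three real embeddings of a totally real cubic field `K` are enumerated by
`σ : Fin 3 ≃ (K →+* ℝ)`. -/

/-- A full module in a cubic field `K`: an additive subgroup `M` generated by three elements with
`ℚ M = K`. -/
structure FullModule (K : Type*) [Field K] [CharZero K] where
  /-- The underlying additive group. -/
  toSubmodule : Submodule ℤ K
  exists_generators : ∃ α : Fin 3 → K, toSubmodule = Submodule.span ℤ (Set.range α)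
  span_rat : Submodule.span ℚ (toSubmodule : Set K) = ⊤

variable {K : Type*} [Field K] [CharZero K]

/-- The associated order `{α ∈ K | α M ⊆ M}`. -/
def FullModule.order (M : FullModule K) : Subring K where
  carrier := {α | ∀ m ∈ M.toSubmodule, α * m ∈ M.toSubmodule}
  mul_mem' := fun ha hb m hm => by
    rw [mul_assoc]
    exact ha _ (hb m hm)
  one_mem' := fun m hm => by rwa [one_mul]
  add_mem' := fun ha hb m hm => by
    rw [add_mul]
    exact add_mem (ha m hm) (hb m hm)
  zero_mem' := fun m _ => by
    rw [zero_mul]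
    exact zero_mem _
  neg_mem' := fun ha m hm => by
    rw [neg_mul]
    exact neg_mem (ha m hm)

/-- The embedding `φ = (σ₁, σ₂, σ₃) : K → ℝ³`. -/
def phi (σ : Fin 3 ≃ (K →+* ℝ)) : K →ₗ[ℤ] (Fin 3 → ℝ) :=
  (RingHom.pi fun i => σ i).toAddMonoidHom.toIntLinearMap

/-- The logarithmic map `ψ(α) = (log |σᵢ(α)|)ᵢ`. -/
def psi (σ : Fin 3 ≃ (K →+* ℝ)) (α : K) : Fin 3 → ℝ :=
  fun i => Real.log |σ i α|

/-- The unit lattice `ψ(O_M^×)`. -/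
def FullModule.logUnits (M : FullModule K) (σ : Fin 3 ≃ (K →+* ℝ)) : Set (Fin 3 → ℝ) :=
  Set.range fun u : M.orderˣ => psi σ ((u : M.order) : K)

/-- The discriminant `D_M`, the square of the covolume of `φ(M)`. -/
def FullModule.disc (M : FullModule K) (σ : Fin 3 ≃ (K →+* ℝ)) : ℝ :=
  ZLattice.covolume (M.toSubmodule.map (phi σ)) ^ 2

/-- The normalized lattice `D_M ^ (-1/6) φ(M)` in `ℝ³`. -/
def FullModule.lattice (M : FullModule K) (σ : Fin 3 ≃ (K →+* ℝ)) : Submodule ℤ (Fin 3 → ℝ) :=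
  (M.disc σ ^ (-(1 / 6) : ℝ)) • M.toSubmodule.map (phi σ)

/-- The matrix `(σᵢ(αⱼ))` is invertible if the `αⱼ` span `K` over `ℚ`. -/
lemma isUnit_embeddingMatrix (σ : Fin 3 ≃ (K →+* ℝ)) (α : Fin 3 → K)
    (hα : Submodule.span ℚ (Set.range α) = ⊤) :
    IsUnit (Matrix.of fun i j => σ i (α j) : Matrix (Fin 3) (Fin 3) ℝ) := by
  rw [← Matrix.linearIndependent_rows_iff_isUnit]
  have hli : LinearIndependent ℝ (fun i => ((σ i : K →* ℝ) : K → ℝ)) :=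
    (linearIndependent_monoidHom K ℝ).comp (fun i => (σ i : K →* ℝ)) (fun i j h => by
      apply σ.injective
      ext a
      exact DFunLike.congr_fun h a)
  rw [Fintype.linearIndependent_iff] at hli ⊢
  intro c hc
  apply hli
  funext a
  have ha : a ∈ Submodule.span ℚ (Set.range α) := by rw [hα]; trivial
  induction ha using Submodule.span_induction with
  | mem x hx =>
    obtain ⟨j, rfl⟩ := hx
    simpa using congrFun hc j
  | zero => simp
  | add x y _ _ hx hy =>
    simp only [Finset.sum_apply, Pi.smul_apply, smul_eq_mul, Pi.zero_apply, MonoidHom.coe_coe,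
      map_add, mul_add, Finset.sum_add_distrib] at hx hy ⊢
    rw [hx, hy, add_zero]
  | smul q x _ hx =>
    simp only [Finset.sum_apply, Pi.smul_apply, smul_eq_mul, Pi.zero_apply, MonoidHom.coe_coe,
      Rat.smul_def, map_mul, map_ratCast] at hx ⊢
    calc ∑ i, c i * ((q : ℝ) * σ i x) = (q : ℝ) * ∑ i, c i * σ i x := by
          rw [Finset.mul_sum]
          exact Finset.sum_congr rfl fun i _ => by ring
      _ = 0 := by rw [hx, mul_zero]

/-- The normalized lattice of a full module is unimodular. -/
lemma FullModule.exists_point (M : FullModule K) (σ : Fin 3 ≃ (K →+* ℝ)) :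
    ∃ x : LatticeSpace, toLattice x = M.lattice σ := by
  obtain ⟨α, hα⟩ := M.exists_generators
  have hspan : Submodule.span ℚ (Set.range α) = ⊤ := by
    rw [← M.span_rat, hα, Submodule.span_span_of_tower]
  set N : Matrix (Fin 3) (Fin 3) ℝ := Matrix.of fun i j => σ i (α j) with hN
  have hU : IsUnit N := isUnit_embeddingMatrix σ α hspan
  have hd0 : N.det ≠ 0 := ((Matrix.isUnit_iff_isUnit_det _).1 hU).ne_zero
  have hli : LinearIndependent ℝ N.col := Matrix.linearIndependent_cols_iff_isUnit.2 hU
  let b : Module.Basis (Fin 3) ℝ (Fin 3 → ℝ) :=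
    basisOfLinearIndependentOfCardEqFinrank hli (by simp)
  have hb : (b : Fin 3 → Fin 3 → ℝ) = N.col := coe_basisOfLinearIndependentOfCardEqFinrank _ _
  have hmap : M.toSubmodule.map (phi σ) = Submodule.span ℤ (Set.range b) := by
    rw [hα, Submodule.map_span, ← Set.range_comp, hb]
    rfl
  have hcov : ZLattice.covolume (Submodule.span ℤ (Set.range b)) = |N.det| := by
    have h1 := ZLattice.covolume_eq_det (Submodule.span ℤ (Set.range b)) (b.restrictScalars ℤ)
    rw [h1, ← Matrix.det_transpose N]
    congr 2
    ext i j
    simp [hb, Module.Basis.restrictScalars_apply, Matrix.col]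
  set c : ℝ := M.disc σ ^ (-(1 / 6) : ℝ) with hc
  have hd : 0 < |N.det| := abs_pos.2 hd0
  have hc3 : c ^ 3 * |N.det| = 1 := by
    rw [hc, FullModule.disc, hmap, hcov, ← Real.rpow_natCast (|N.det|) 2, ← Real.rpow_mul hd.le,
      ← Real.rpow_natCast _ 3, ← Real.rpow_mul hd.le]
    norm_num
    rw [Real.rpow_neg_one, inv_mul_cancel₀ hd.ne']
  obtain ⟨s, hs, hsd⟩ : ∃ s : ℤ, s * s = 1 ∧ (s : ℝ) * N.det = |N.det| := by
    rcases lt_or_gt_of_ne hd0 with h | h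
    · exact ⟨-1, by norm_num, by rw [abs_of_neg h]; push_cast; ring⟩
    · exact ⟨1, by norm_num, by rw [abs_of_pos h]; push_cast; ring⟩
  have hsR : (s : ℝ) * s = 1 := by exact_mod_cast hs
  set e : Fin 3 → ℝ := ![(s : ℝ), 1, 1] with he
  have hee : ∀ i, e i * e i = 1 := by
    intro i
    fin_cases i <;> simp [he, hsR]
  have hez : ∀ i, ∃ n : ℤ, (n : ℝ) = e i := by
    intro i
    fin_cases i
    · exact ⟨s, by simp [he]⟩
    · exact ⟨1, by simp [he]⟩
    · exact ⟨1, by simp [he]⟩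
  have hdet : (c • (N * Matrix.diagonal e)).det = 1 := by
    rw [Matrix.det_smul, Matrix.det_mul, Matrix.det_diagonal, Fin.prod_univ_three, ← hc3, ← hsd]
    simp only [he, Fintype.card_fin, Matrix.cons_val]
    ring
  obtain ⟨g, hg⟩ : ∃ g : SL(3, ℝ), (g : Matrix (Fin 3) (Fin 3) ℝ) = c • (N * Matrix.diagonal e) :=
    ⟨⟨_, hdet⟩, rfl⟩
  refine ⟨QuotientGroup.mk g, ?_⟩
  rw [toLattice_mk]
  have hact : actMap g =
      (DistribSMul.toLinearMap ℤ (Fin 3 → ℝ) c).comp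
        (((Matrix.toLin' N).restrictScalars ℤ).comp
          ((Matrix.toLin' (Matrix.diagonal e)).restrictScalars ℤ)) := by
    ext v
    simp [actMap, hg]
  have hdiag_le : stdLattice.map ((Matrix.toLin' (Matrix.diagonal e)).restrictScalars ℤ) ≤
      stdLattice := by
    rintro _ ⟨v, hv, rfl⟩
    rw [SetLike.mem_coe, mem_stdLattice] at hv
    rw [mem_stdLattice]
    intro i
    obtain ⟨n, hn⟩ := hv i
    obtain ⟨m, hm⟩ := hez i
    exact ⟨m * n, by simp [Matrix.mulVec_diagonal, hn, hm]⟩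
  have hdiag : stdLattice.map ((Matrix.toLin' (Matrix.diagonal e)).restrictScalars ℤ) =
      stdLattice := by
    refine le_antisymm hdiag_le fun v hv => ?_
    refine ⟨_, hdiag_le (Submodule.mem_map_of_mem hv), ?_⟩
    ext i
    simp [Matrix.mulVec_diagonal, ← mul_assoc, hee]
  rw [hact, Submodule.map_comp, Submodule.map_comp, hdiag, FullModule.lattice, hmap, ← hc]
  have hstd : stdLattice.map ((Matrix.toLin' N).restrictScalars ℤ) =
      Submodule.span ℤ (Set.range b) := by
    rw [stdLattice, Submodule.map_span, ← Set.range_comp, hb]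
    congr 2
    ext j i
    simp [Matrix.col]
  rw [hstd]
  rfl

/-- The point `L_M` of `X` whose lattice is `D_M ^ (-1/6) φ(M)`. -/
def FullModule.point (M : FullModule K) (σ : Fin 3 ≃ (K →+* ℝ)) : LatticeSpace :=
  (M.exists_point σ).choose

lemma FullModule.toLattice_point (M : FullModule K) (σ : Fin 3 ≃ (K →+* ℝ)) :
    toLattice (M.point σ) = M.lattice σ :=
  (M.exists_point σ).choose_spec

/-! ### Simplex sets and tightness -/

/-- The plane `ℝ³₀` of vectors with coordinate sum zero. -/
def sumZero : Submodule ℝ (Fin 3 → ℝ) where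
  carrier := {v | ∑ i, v i = 0}
  add_mem' := fun {a b} ha hb => by
    simp only [Set.mem_ofPred_eq] at ha hb
    simp [Finset.sum_add_distrib, ha, hb]
  zero_mem' := by simp
  smul_mem' := fun c v hv => by
    simp only [Set.mem_ofPred_eq] at hv
    simp [← Finset.mul_sum, hv]

/-- `Φ = {α₁, α₂, α₃}` is a simplex set: it spans `ℝ³₀` and `α₁ + α₂ + α₃ = 0`. (The three
vectors are then automatically distinct.) -/
def IsSimplexSet (Φ : Fin 3 → Fin 3 → ℝ) : Prop :=
  Submodule.span ℝ (Set.range Φ) = sumZero ∧ ∑ j, Φ j = 0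

/-- The six points `W_Φ = {∑ λⱼ αⱼ | {λ₁, λ₂, λ₃} = {0, 1/3, 2/3}}`. -/
def hexVertices (Φ : Fin 3 → Fin 3 → ℝ) : Set (Fin 3 → ℝ) :=
  {w | ∃ l : Fin 3 → ℝ, Set.range l = {0, 1 / 3, 2 / 3} ∧ w = ∑ j, l j • Φ j}

/-- `⌈S⌉`, the maximum of all coordinates of all vectors in the (finite) set `S`. -/
def ceilSet (S : Set (Fin 3 → ℝ)) : ℝ :=
  sSup {t | ∃ v ∈ S, ∃ i, t = v i}

/-- A simplex set `Φ ⊆ ψ(O_M^×)` is `(R, r)`-tight if `exp (r ⌈W_Φ⌉) ≤ ht(L_M) R`. -/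
structure IsTight (M : FullModule K) (σ : Fin 3 ≃ (K →+* ℝ)) (R r : ℝ)
    (Φ : Fin 3 → Fin 3 → ℝ) : Prop where
  isSimplexSet : IsSimplexSet Φ
  mem_logUnits : ∀ j, Φ j ∈ M.logUnits σ
  exp_le : Real.exp (r * ceilSet (hexVertices Φ)) ≤ height (toLattice (M.point σ)) * R

end

end CubicOrbit

namespace CubicOrbit

noncomputable section

variable {K : Type*} [Field K] [CharZero K]

/-! ### Topology of the space of lattices and of its cusp neighbourhoods -/

/-! Write `w` for `ceilSet (hexVertices Φ)`. A simplex set gives coordinates `q ↦ q 0 • Φ 0 + q 1 •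
Φ 1` on the plane of trace zero, and hence on the orbit of `L_M` through the exponential. A unit
acts on `L_M` by `exp` of its logarithm up to signs. Squares of units therefore stabilize `L_M`, so
the orbit is a compact torus with a unique periodic measure. Signs do not change Euclidean norms, so
the times at which the orbit lies in `cusp δ` are already periodic under `ℤ²`, and the periodic
measure of `cusp δ` is the density of this periodic set (`IsPeriodicMeasure.measure_eq`).

Tightness gives `L_M` a nonzero vector shorter than `2 * R * exp (-r * w)`. The hexagon spanned by
`W_Φ` is a fundamental domain for `ℤ²`, and on its dilate by `t` every coordinate of the logarithm
is at most `t * w` (`IsSimplexSet.plane_le`). There the vector stays shorter than `2 * R * exp ((t -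
r) * w)`. The dilate has area `t ^ 2`, and for `t < 1` its integer translates are disjoint, so mass
at least `t ^ 2` lies at that depth (`IsTight.le_measure_cusp`).

For `t < r` the depth is unbounded provided `w → ∞` (`tendsto_ceilSet`). A bounded `w` would bound
the conjugates of an irrational unit: there are finitely many such units, each lying in finitely
many orders of the cubic field it generates. A compact set misses a sufficiently deep cusp, so a
limit measure has mass at most `1 - t ^ 2`; then `t → r` (`escapeOfMass_of_cusp`). -/

instance : SecondCountableTopology SL(3, ℝ) :=
  haveI : SecondCountableTopology (Matrix (Fin 3) (Fin 3) ℝ) :=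
    inferInstanceAs (SecondCountableTopology (Fin 3 → Fin 3 → ℝ))
  (Matrix.SpecialLinearGroup.isClosedEmbedding_val (n := Fin 3)
    (R := ℝ)).isEmbedding.secondCountableTopology

instance : LocallyCompactSpace SL(3, ℝ) :=
  haveI : LocallyCompactSpace (Matrix (Fin 3) (Fin 3) ℝ) :=
    inferInstanceAs (LocallyCompactSpace (Fin 3 → Fin 3 → ℝ))
  (Matrix.SpecialLinearGroup.isClosedEmbedding_val (n := Fin 3)
    (R := ℝ)).locallyCompactSpace

instance : SecondCountableTopology LatticeSpace :=
  QuotientGroup.instSecondCountableTopology integerPoints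

instance : LocallyCompactSpace LatticeSpace :=
  QuotientGroup.instLocallyCompactSpace integerPoints

lemma toLattice_smul (g : SL(3, ℝ)) (x : LatticeSpace) :
    toLattice (g • x) = (toLattice x).map (actMap g) := by
  induction x using QuotientGroup.induction_on with | _ h
  change toLattice (QuotientGroup.mk (g * h)) = _
  rw [toLattice_mk, toLattice_mk, actMap_mul, Submodule.map_comp]

lemma posDiag_smul (a : posDiag) (x : LatticeSpace) : a • x = (a : SL(3, ℝ)) • x := rfl

/-- The lattices that contain a nonzero vector of norm less than `δ`. -/
def cusp (δ : ℝ) : Set LatticeSpace :=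
  {x | ∃ v ∈ toLattice x, v ≠ 0 ∧ ‖WithLp.toLp 2 v‖ < δ}

/-- For each fixed integer vector `v` the condition `‖g v‖ < δ` is open in `g`, and the preimage of
the cusp is a union of such conditions. -/
lemma isOpen_cusp (δ : ℝ) : IsOpen (cusp δ) := by
  rw [← (QuotientGroup.isOpenQuotientMap_mk (N := integerPoints)).isQuotientMap.isOpen_preimage]
  have : (QuotientGroup.mk : SL(3, ℝ) → LatticeSpace) ⁻¹' cusp δ =
      ⋃ v ∈ {v ∈ stdLattice | v ≠ 0},
        {g : SL(3, ℝ) | ‖WithLp.toLp 2 ((g : Matrix (Fin 3) (Fin 3) ℝ).mulVec v)‖ < δ} := by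
    ext g
    simp only [Set.mem_preimage, cusp, Set.mem_ofPred_eq, toLattice_mk, Set.mem_iUnion,
      Submodule.mem_map, exists_prop]
    constructor
    · rintro ⟨_, ⟨v, hv, rfl⟩, h0, hn⟩
      exact ⟨v, ⟨hv, fun h => h0 (by rw [h, map_zero])⟩, hn⟩
    · rintro ⟨v, ⟨hv, h0⟩, hn⟩
      refine ⟨_, ⟨v, hv, rfl⟩, fun h => h0 ?_, hn⟩
      have h1 : actMap (g⁻¹ * g) v = 0 := by
        rw [actMap_mul, LinearMap.comp_apply, h, map_zero]
      simpa [actMap] using h1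
  rw [this]
  refine isOpen_biUnion fun v _ => isOpen_lt ?_ continuous_const
  have hc : Continuous fun g : SL(3, ℝ) => (g : Matrix (Fin 3) (Fin 3) ℝ) :=
    continuous_subtype_val
  fun_prop

lemma cusp_mono {δ ε : ℝ} (h : δ ≤ ε) : cusp δ ⊆ cusp ε :=
  fun _ ⟨v, hv, h0, hn⟩ => ⟨v, hv, h0, hn.trans_le h⟩

lemma one_le_norm_of_mem_stdLattice {v : Fin 3 → ℝ} (hv : v ∈ stdLattice) (h0 : v ≠ 0) :
    1 ≤ ‖WithLp.toLp 2 v‖ := by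
  obtain ⟨i, hi⟩ := Function.ne_iff.1 h0
  obtain ⟨n, hn⟩ := (mem_stdLattice v).1 hv i
  refine le_trans ?_ (PiLp.norm_apply_le (WithLp.toLp 2 v) i)
  change 1 ≤ ‖v i‖
  rw [← hn] at hi ⊢
  have h1 : n ≠ 0 := by
    rintro rfl
    exact hi (by simp)
  rw [Real.norm_eq_abs]
  exact_mod_cast Int.one_le_abs h1

/-- Every point of `X` has a neighbourhood that avoids a part of the cusp. -/
lemma exists_notMem_cusp (x : LatticeSpace) : ∃ δ > 0, ∃ U ∈ 𝓝 x, Disjoint U (cusp δ) := by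
  induction x using QuotientGroup.induction_on with | _ g
  -- `T h` is the operator `h⁻¹`. From `1 ≤ ‖v‖ ≤ ‖T h‖ * ‖h v‖`, an upper bound for `‖T h‖` keeps
  -- the lattice of `h` out of the cusp; adding 1 to `‖T g‖` makes the bound hold near `g`.
  set T : SL(3, ℝ) → (EuclideanSpace ℝ (Fin 3) →L[ℝ] EuclideanSpace ℝ (Fin 3)) :=
    fun h => Matrix.toEuclideanCLM (𝕜 := ℝ) ((h⁻¹ : SL(3, ℝ)) : Matrix (Fin 3) (Fin 3) ℝ) with hT
  have hTc : Continuous T := by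
    have h1 : Continuous fun h : SL(3, ℝ) => ((h⁻¹ : SL(3, ℝ)) : Matrix (Fin 3) (Fin 3) ℝ) :=
      continuous_subtype_val.comp continuous_inv
    have h2 : Continuous (Matrix.toEuclideanCLM (n := Fin 3) (𝕜 := ℝ)) :=
      LinearMap.continuous_of_finiteDimensional
        (Matrix.toEuclideanCLM (n := Fin 3) (𝕜 := ℝ)).toAlgEquiv.toLinearMap
    exact h2.comp h1
  have hpos : 0 < ‖T g‖ + 1 := by positivity
  refine ⟨(‖T g‖ + 1)⁻¹, inv_pos.2 hpos, QuotientGroup.mk '' {h | ‖T h‖ < ‖T g‖ + 1}, ?_, ?_⟩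
  · exact (QuotientGroup.isOpenMap_coe).image_mem_nhds
      ((isOpen_lt hTc.norm continuous_const).mem_nhds (by simp))
  · rw [Set.disjoint_left]
    rintro _ ⟨h, hh, rfl⟩ ⟨_, ⟨v, hv, rfl⟩, h0, hn⟩
    have hv0 : v ≠ 0 := fun h => h0 (by rw [h, map_zero])
    have h1 := one_le_norm_of_mem_stdLattice hv hv0
    have h2 : T h (WithLp.toLp 2 (actMap h v)) = WithLp.toLp 2 v := by
      have h3 : actMap (h⁻¹ * h) v = v := by simp [actMap]
      rw [actMap_mul, LinearMap.comp_apply] at h3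
      simpa [hT, actMap] using h3
    have h4 := (T h).le_opNorm (WithLp.toLp 2 (actMap h v))
    rw [h2] at h4
    have h5 : ‖T h‖ * ‖WithLp.toLp 2 (actMap h v)‖ < 1 := by
      calc _ ≤ (‖T g‖ + 1) * ‖WithLp.toLp 2 (actMap h v)‖ :=
            mul_le_mul_of_nonneg_right (le_of_lt hh) (norm_nonneg _)
        _ < (‖T g‖ + 1) * (‖T g‖ + 1)⁻¹ := by
            exact mul_lt_mul_of_pos_left hn hpos
        _ = 1 := mul_inv_cancel₀ hpos.ne'
    linarith

/-- Compact sets do not reach far into the cusp. -/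
lemma exists_disjoint_cusp_of_isCompact {C : Set LatticeSpace} (hC : IsCompact C) :
    ∃ δ > 0, Disjoint C (cusp δ) := by
  refine hC.induction_on (p := fun C => ∃ δ > 0, Disjoint C (cusp δ)) ⟨1, one_pos, by simp⟩ ?_ ?_ ?_
  · rintro s t hst ⟨δ, hδ, h⟩
    exact ⟨δ, hδ, h.mono_left hst⟩
  · rintro s t ⟨δ, hδ, h⟩ ⟨ε, hε, h'⟩
    exact ⟨min δ ε, lt_min hδ hε, Set.disjoint_union_left.2
      ⟨h.mono_right (cusp_mono (min_le_left _ _)), h'.mono_right (cusp_mono (min_le_right _ _))⟩⟩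
  · intro x _
    obtain ⟨δ, hδ, U, hU, h⟩ := exists_notMem_cusp x
    exact ⟨U, mem_nhdsWithin_of_mem_nhds hU, δ, hδ, h⟩

/-! ### Periodic sets in the plane -/

/-- The unit square `[0, 1)²`. -/
def unitSquare : Set (Fin 2 → ℝ) := ZSpan.fundamentalDomain (Pi.basisFun ℝ (Fin 2))

/-- The lattice `ℤ²`. -/
abbrev intPlane : Submodule ℤ (Fin 2 → ℝ) :=
  Submodule.span ℤ (Set.range (Pi.basisFun ℝ (Fin 2)))

lemma mem_intPlane (v : Fin 2 → ℝ) : v ∈ intPlane ↔ ∀ i, ∃ n : ℤ, (n : ℝ) = v i := by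
  rw [intPlane, Module.Basis.mem_span_iff_repr_mem]
  simp

lemma measurableSet_unitSquare : MeasurableSet unitSquare :=
  ZSpan.fundamentalDomain_measurableSet _

lemma volume_unitSquare : volume unitSquare = 1 := by
  rw [unitSquare, ZSpan.volume_fundamentalDomain]
  have : (Matrix.of (Pi.basisFun ℝ (Fin 2)) : Matrix (Fin 2) (Fin 2) ℝ) = 1 := by
    ext i j
    simp [Matrix.one_apply, Pi.single_apply, eq_comm]
  rw [this]
  simp

lemma isAddFundamentalDomain_unitSquare :
    IsAddFundamentalDomain intPlane unitSquare (volume : Measure (Fin 2 → ℝ)) :=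
  ZSpan.isAddFundamentalDomain _ _

instance : Countable intPlane := inferInstanceAs
  (Countable (Submodule.span ℤ (Set.range (Pi.basisFun ℝ (Fin 2)))))

instance : VAddInvariantMeasure intPlane (Fin 2 → ℝ) volume :=
  ⟨fun c s _ => measure_preimage_add volume (c : Fin 2 → ℝ) s⟩

/-- A set that is invariant under the translations by `ℤ²`. -/
def IsPeriodicSet (E : Set (Fin 2 → ℝ)) : Prop :=
  ∀ n ∈ intPlane, ∀ q, n + q ∈ E ↔ q ∈ E

/-- A translate of the unit square is again a fundamental domain. The density of a periodic set is
thus independent of the base point on the orbit. -/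
lemma IsPeriodicSet.volume_translate {E : Set (Fin 2 → ℝ)} (hE : IsPeriodicSet E)
    (hm : MeasurableSet E) (p : Fin 2 → ℝ) :
    volume ({q | p + q ∈ E} ∩ unitSquare) = volume (E ∩ unitSquare) := by
  have h2 : IsAddFundamentalDomain intPlane (p +ᵥ unitSquare)
      (volume : Measure (Fin 2 → ℝ)) :=
    isAddFundamentalDomain_unitSquare.vadd_of_comm p
  rw [isAddFundamentalDomain_unitSquare.measure_set_eq h2 hm
    (fun n => Set.ext fun q => hE n n.2 q),
    ← measure_preimage_add volume p (E ∩ (p +ᵥ unitSquare))]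
  congr 1
  ext q
  simp [Set.mem_vadd_set]

/-- A periodic set contains at least the volume of a set whose translates are disjoint. -/
lemma IsPeriodicSet.volume_le {E H : Set (Fin 2 → ℝ)} (hE : IsPeriodicSet E)
    (hHm : MeasurableSet H) (hHE : H ⊆ E)
    (hH : ∀ n ∈ intPlane, ∀ q ∈ H, n + q ∈ H → n = 0) :
    volume H ≤ volume (E ∩ unitSquare) := by
  -- Cut `H` along the integer grid and move all pieces into the unit square. They remain in `E` by
  -- periodicity and are disjoint by `hH`.
  rw [isAddFundamentalDomain_unitSquare.measure_eq_tsum H, ← measure_iUnion]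
  · refine measure_mono (Set.iUnion_subset fun n => Set.inter_subset_inter_left _ ?_)
    rintro _ ⟨q, hq, rfl⟩
    exact (hE n n.2 q).2 (hHE hq)
  · intro m n hmn
    refine Set.disjoint_left.2 ?_
    rintro x ⟨⟨q, hq, rfl⟩, -⟩ ⟨⟨q', hq', h⟩, -⟩
    apply hmn
    have h' : (n : Fin 2 → ℝ) + q' = m + q := h
    have h1 := hH ((n : Fin 2 → ℝ) - m) (sub_mem n.2 m.2) q' hq' (by
      rwa [show (n : Fin 2 → ℝ) - m + q' = q by rw [sub_add_eq_add_sub, h', add_sub_cancel_left]])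
    exact (Subtype.ext (sub_eq_zero.1 h1)).symm
  · intro n
    exact (hHm.const_vadd n).inter measurableSet_unitSquare

/-! ### The hexagon -/

/-- The hexagon with vertices `± t (2/3, 1/3)`, `± t (1/3, 2/3)`, `± t (1/3, - 1/3)`. -/
def hexagon (t : ℝ) : Set (Fin 2 → ℝ) :=
  {q | |2 * q 0 - q 1| ≤ t ∧ |2 * q 1 - q 0| ≤ t ∧ |q 0 + q 1| ≤ t}

lemma measurableSet_hexagon (t : ℝ) : MeasurableSet (hexagon t) := by
  have h (f : (Fin 2 → ℝ) → ℝ) (hf : Continuous f) : MeasurableSet {q | f q ≤ t} :=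
    (isClosed_le hf continuous_const).measurableSet
  exact (h (fun q => |2 * q 0 - q 1|) (by fun_prop)).inter
    ((h (fun q => |2 * q 1 - q 0|) (by fun_prop)).inter (h (fun q => |q 0 + q 1|) (by fun_prop)))

/-- The translates of the hexagon cover the plane. -/
lemma exists_add_mem_hexagon (q : Fin 2 → ℝ) : ∃ n ∈ intPlane, n + q ∈ hexagon 1 := by
  suffices h : ∃ m n : ℤ, (![(m : ℝ), n] + q) ∈ hexagon 1 by
    obtain ⟨m, n, h⟩ := h
    refine ⟨_, (mem_intPlane _).2 fun i => ?_, h⟩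
    fin_cases i
    exacts [⟨m, rfl⟩, ⟨n, rfl⟩]
  have hx0 := Int.fract_nonneg (q 0)
  have hx1 := (Int.fract_lt_one (q 0)).le
  have hy0 := Int.fract_nonneg (q 1)
  have hy1 := (Int.fract_lt_one (q 1)).le
  have hx := Int.fract_add_floor (q 0)
  have hy := Int.fract_add_floor (q 1)
  set x := Int.fract (q 0)
  set y := Int.fract (q 1)
  suffices h : ∃ a b : ℤ, |2 * (a + x) - (b + y)| ≤ 1 ∧ |2 * (b + y) - (a + x)| ≤ 1 ∧
      |(a + x) + (b + y)| ≤ 1 by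
    obtain ⟨a, b, h⟩ := h
    refine ⟨a - ⌊q 0⌋, b - ⌊q 1⌋, ?_⟩
    simp only [hexagon, Set.mem_ofPred_eq, Pi.add_apply, Matrix.cons_val_zero,
      Matrix.cons_val_one]
    have e0 : ((a - ⌊q 0⌋ : ℤ) : ℝ) + q 0 = a + x := by push_cast; linarith
    have e1 : ((b - ⌊q 1⌋ : ℤ) : ℝ) + q 1 = b + y := by push_cast; linarith
    rwa [e0, e1]
  simp only [abs_le]
  -- The unit square is cut into six pieces, each lying in the translate of the hexagon centred at
  -- one of the four corners.
  by_cases h1 : x + y ≤ 1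
  · by_cases h2 : 2 * x - y ≤ 1
    · by_cases h3 : 2 * y - x ≤ 1
      · exact ⟨0, 0, by push_cast; refine ⟨⟨?_, ?_⟩, ⟨?_, ?_⟩, ?_, ?_⟩ <;> linarith⟩
      · exact ⟨0, -1, by push_cast; refine ⟨⟨?_, ?_⟩, ⟨?_, ?_⟩, ?_, ?_⟩ <;> linarith⟩
    · exact ⟨-1, 0, by push_cast; refine ⟨⟨?_, ?_⟩, ⟨?_, ?_⟩, ?_, ?_⟩ <;> linarith⟩
  · by_cases h2 : 2 * x - y < 0
    · exact ⟨0, -1, by push_cast; refine ⟨⟨?_, ?_⟩, ⟨?_, ?_⟩, ?_, ?_⟩ <;> linarith⟩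
    · by_cases h3 : 2 * y - x < 0
      · exact ⟨-1, 0, by push_cast; refine ⟨⟨?_, ?_⟩, ⟨?_, ?_⟩, ?_, ?_⟩ <;> linarith⟩
      · exact ⟨-1, -1, by push_cast; refine ⟨⟨?_, ?_⟩, ⟨?_, ?_⟩, ?_, ?_⟩ <;> linarith⟩

/-- Covering the plane by translates suffices for a lower bound on the area. -/
lemma one_le_volume_hexagon : 1 ≤ volume (hexagon 1) := by
  rw [isAddFundamentalDomain_unitSquare.measure_eq_tsum (hexagon 1), ← volume_unitSquare]
  refine le_trans (measure_mono ?_) (measure_iUnion_le _)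
  intro q hq
  obtain ⟨n, hn, h⟩ := exists_add_mem_hexagon q
  exact Set.mem_iUnion.2 ⟨-⟨n, hn⟩, ⟨n + q, h, neg_add_cancel_left n q⟩, hq⟩

lemma le_volume_hexagon {t : ℝ} (ht : 0 < t) :
    ENNReal.ofReal (t ^ 2) ≤ volume (hexagon t) := by
  have h : hexagon t = t • hexagon 1 := by
    ext q
    rw [Set.mem_smul_set_iff_inv_smul_mem₀ ht.ne']
    simp only [hexagon, Set.mem_ofPred_eq, Pi.smul_apply, smul_eq_mul]
    have e (a : ℝ) : |a| ≤ t ↔ |t⁻¹ * a| ≤ 1 := by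
      rw [abs_mul, abs_of_pos (inv_pos.2 ht), inv_mul_le_iff₀ ht, mul_one]
    rw [e, e (2 * q 1 - q 0), e (q 0 + q 1)]
    ring_nf
  rw [h, Measure.addHaar_smul]
  simp only [Module.finrank_fintype_fun_eq_card, Fintype.card_fin, abs_of_pos (pow_pos ht 2)]
  calc ENNReal.ofReal (t ^ 2) = ENNReal.ofReal (t ^ 2) * 1 := (mul_one _).symm
    _ ≤ _ := by gcongr; exact one_le_volume_hexagon

/-- The translates of a small hexagon are disjoint. -/
lemma eq_zero_of_add_mem_hexagon {t : ℝ} (ht : t < 1) :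
    ∀ n ∈ intPlane, ∀ q ∈ hexagon t, n + q ∈ hexagon t → n = 0 := by
  intro n hn q ⟨h1, h2, h3⟩ ⟨h4, h5, h6⟩
  obtain ⟨a, ha⟩ := (mem_intPlane n).1 hn 0
  obtain ⟨b, hb⟩ := (mem_intPlane n).1 hn 1
  simp only [Pi.add_apply, ← ha, ← hb] at h4 h5 h6
  rw [abs_le] at h1 h2 h3 h4 h5 h6
  -- Each form takes values of size at most `t < 1` at both points, so its integer value at the
  -- difference is at most 1 in size; then `3 * a = (2 * a - b) + (a + b)` forces `a = 0`, and
  -- likewise `b = 0`.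
  have k1 : (2 * a - b : ℝ) < 2 := by linarith
  have k2 : (-2 : ℝ) < 2 * a - b := by linarith
  have k3 : (2 * b - a : ℝ) < 2 := by linarith
  have k4 : (-2 : ℝ) < 2 * b - a := by linarith
  have k5 : (a + b : ℝ) < 2 := by linarith
  have k6 : (-2 : ℝ) < a + b := by linarith
  norm_cast at k1 k2 k3 k4 k5 k6
  have ha0 : a = 0 := by omega
  have hb0 : b = 0 := by omega
  funext i
  fin_cases i
  · simp [← ha, ha0]
  · simp [← hb, hb0]

/-- A periodic set that contains a small hexagon has density at least `t ^ 2`. -/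
lemma IsPeriodicSet.le_volume {E : Set (Fin 2 → ℝ)} (hE : IsPeriodicSet E) {t : ℝ} (ht : 0 < t)
    (ht1 : t < 1) (h : hexagon t ⊆ E) : ENNReal.ofReal (t ^ 2) ≤ volume (E ∩ unitSquare) :=
  (le_volume_hexagon ht).trans
    (hE.volume_le (measurableSet_hexagon t) h (eq_zero_of_add_mem_hexagon ht1))

/-! ### The diagonal flow and periodic measures -/

lemma sum_eq_zero_of_mem_sumZero {v : Fin 3 → ℝ} (hv : v ∈ sumZero) : ∑ i, v i = 0 := hv

/-- The diagonal matrix `exp v`, for a vector `v` with coordinate sum zero. -/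
def expDiag (v : sumZero) : posDiag :=
  ⟨⟨Matrix.diagonal fun i => Real.exp ((v : Fin 3 → ℝ) i), by
    rw [Matrix.det_diagonal, ← Real.exp_sum, sum_eq_zero_of_mem_sumZero v.2, Real.exp_zero]⟩,
    fun i => Real.exp ((v : Fin 3 → ℝ) i), fun _ => Real.exp_pos _, rfl⟩

lemma coe_expDiag (v : sumZero) : ((expDiag v : SL(3, ℝ)) : Matrix (Fin 3) (Fin 3) ℝ) =
    Matrix.diagonal fun i => Real.exp ((v : Fin 3 → ℝ) i) := rfl

lemma expDiag_add (v w : sumZero) : expDiag (v + w) = expDiag v * expDiag w := by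
  apply Subtype.ext
  apply Subtype.ext
  rw [Subgroup.coe_mul, Matrix.SpecialLinearGroup.coe_mul, coe_expDiag, coe_expDiag, coe_expDiag,
    Matrix.diagonal_mul_diagonal]
  simp [Real.exp_add]

lemma expDiag_zero : expDiag 0 = 1 := by
  apply Subtype.ext
  apply Subtype.ext
  simp [coe_expDiag]

lemma expDiag_surjective : Function.Surjective expDiag := by
  rintro ⟨g, d, hd, hg⟩
  have hdet : ∏ i, d i = 1 := by
    rw [← Matrix.det_diagonal, ← hg, Matrix.SpecialLinearGroup.det_coe]
  refine ⟨⟨fun i => Real.log (d i), ?_⟩, ?_⟩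
  · change ∑ i, Real.log (d i) = 0
    rw [← Real.log_prod fun i _ => (hd i).ne', hdet, Real.log_one]
  · apply Subtype.ext
    apply Subtype.ext
    simp [coe_expDiag, hg, Real.exp_log (hd _)]

lemma continuous_expDiag : Continuous fun v : sumZero => (expDiag v : SL(3, ℝ)) := by
  refine (Matrix.SpecialLinearGroup.isClosedEmbedding_val (n := Fin 3)
    (R := ℝ)).isInducing.continuous_iff.2 ?_
  change Continuous fun v : sumZero => Matrix.diagonal fun i => Real.exp ((v : Fin 3 → ℝ) i)
  exact Continuous.matrix_diagonal (continuous_pi fun i =>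
    Real.continuous_exp.comp ((continuous_apply i).comp continuous_subtype_val))

lemma actMap_expDiag (v : sumZero) (w : Fin 3 → ℝ) :
    actMap (expDiag v) w = fun i => Real.exp ((v : Fin 3 → ℝ) i) * w i := by
  ext i
  simp [actMap, coe_expDiag, Matrix.mulVec_diagonal]

/-- A parametrization of the orbit of `x` by the plane. -/
def flow (e : (Fin 2 → ℝ) →ₗ[ℝ] sumZero) (q : Fin 2 → ℝ) (x : LatticeSpace) : LatticeSpace :=
  expDiag (e q) • x

lemma flow_add (e : (Fin 2 → ℝ) →ₗ[ℝ] sumZero) (p q : Fin 2 → ℝ) (x : LatticeSpace) :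
    flow e (p + q) x = flow e p (flow e q x) := by
  rw [flow, map_add, expDiag_add, mul_smul, flow, flow]

lemma continuous_flow (e : (Fin 2 → ℝ) →ₗ[ℝ] sumZero) :
    Continuous fun z : (Fin 2 → ℝ) × LatticeSpace => flow e z.1 z.2 := by
  have he : Continuous e := e.continuous_of_finiteDimensional
  exact (continuous_expDiag.comp (he.comp continuous_fst)).smul continuous_snd

lemma continuous_flow_left (e : (Fin 2 → ℝ) →ₗ[ℝ] sumZero) (x : LatticeSpace) :
    Continuous fun q => flow e q x :=
  Continuous.comp (g := fun z : (Fin 2 → ℝ) × LatticeSpace => flow e z.1 z.2)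
    (f := fun q => (q, x)) (continuous_flow e) (by fun_prop)

lemma exists_flow_eq {e : (Fin 2 → ℝ) →ₗ[ℝ] sumZero} (he : Function.Surjective e)
    (a : posDiag) : ∃ q, ∀ x, flow e q x = a • x := by
  obtain ⟨v, rfl⟩ := expDiag_surjective a
  obtain ⟨q, rfl⟩ := he v
  exact ⟨q, fun _ => rfl⟩

/-- The periodic measure of a set whose pull-back to the plane is periodic. -/
lemma IsPeriodicMeasure.measure_eq {x : LatticeSpace} {μ : Measure LatticeSpace}
    (h : IsPeriodicMeasure x μ) {e : (Fin 2 → ℝ) →ₗ[ℝ] sumZero} (he : Function.Surjective e)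
    {B : Set LatticeSpace} (hB : MeasurableSet B) (hper : IsPeriodicSet {q | flow e q x ∈ B}) :
    μ B = volume ({q | flow e q x ∈ B} ∩ unitSquare) := by
  have := h.isProbabilityMeasure
  have hS : MeasurableSet {z : (Fin 2 → ℝ) × LatticeSpace | flow e z.1 z.2 ∈ B} :=
    (continuous_flow e).measurable hB
  -- The product measure of `{(q, y) | flow e q y ∈ B}` is computed in both orders. Here the
  -- `μ`-integral comes first and is constant by invariance; in `h2` the integral over the square
  -- comes first and is constant along the orbit. Only the visits to `B`, not the flow itself, need
  -- to be periodic.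
  have h1 : ((volume : Measure (Fin 2 → ℝ)).restrict unitSquare).prod μ
      {z | flow e z.1 z.2 ∈ B} = μ B := by
    rw [Measure.prod_apply hS]
    have (q : Fin 2 → ℝ) : μ (Prod.mk q ⁻¹' {z | flow e z.1 z.2 ∈ B}) = μ B :=
      h.invariant.measure_preimage_smul (expDiag (e q)) hB
    simp only [this, lintegral_const, Measure.restrict_apply_univ, volume_unitSquare, mul_one]
  have h2 : ((volume : Measure (Fin 2 → ℝ)).restrict unitSquare).prod μ
      {z | flow e z.1 z.2 ∈ B} = volume ({q | flow e q x ∈ B} ∩ unitSquare) := by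
    rw [Measure.prod_apply_symm hS]
    have hae : ∀ᵐ y ∂μ, (volume : Measure (Fin 2 → ℝ)).restrict unitSquare
        ((fun q => (q, y)) ⁻¹' {z | flow e z.1 z.2 ∈ B}) =
          volume ({q | flow e q x ∈ B} ∩ unitSquare) := by
      have hmem : ∀ᵐ y ∂μ, y ∈ MulAction.orbit posDiag x := h.supported
      filter_upwards [hmem] with y hy
      obtain ⟨a, rfl⟩ := hy
      obtain ⟨p, hp⟩ := exists_flow_eq he a
      change (volume : Measure (Fin 2 → ℝ)).restrict unitSquare
        ((fun q => flow e q (a • x)) ⁻¹' B) = _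
      rw [Measure.restrict_apply ((continuous_flow_left e _).measurable hB),
        ← hper.volume_translate ((continuous_flow_left e x).measurable hB) p]
      congr 2
      ext q
      change flow e q (a • x) ∈ B ↔ flow e (p + q) x ∈ B
      rw [← hp, ← flow_add, add_comm]
    rw [lintegral_congr_ae hae, lintegral_const, measure_univ, mul_one]
  rw [← h1, h2]

/-- An orbit whose stabilizer contains a lattice carries exactly one periodic measure. -/
lemma existsUnique_isPeriodicMeasure {x : LatticeSpace} {e : (Fin 2 → ℝ) →ₗ[ℝ] sumZero}
    (he : Function.Surjective e) (hx : ∀ n ∈ intPlane, flow e n x = x) :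
    ∃! μ : Measure LatticeSpace, IsPeriodicMeasure x μ := by
  have hper (B : Set LatticeSpace) : IsPeriodicSet {q | flow e q x ∈ B} := by
    intro n hn q
    change flow e (n + q) x ∈ B ↔ flow e q x ∈ B
    rw [add_comm, flow_add, hx n hn]
  have hcont := continuous_flow_left e x
  have happ {B : Set LatticeSpace} (hB : MeasurableSet B) :
      ((volume : Measure (Fin 2 → ℝ)).restrict unitSquare).map (fun q => flow e q x) B =
        volume ({q | flow e q x ∈ B} ∩ unitSquare) := by
    rw [Measure.map_apply hcont.measurable hB, Measure.restrict_apply (hcont.measurable hB)]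
    rfl
  refine ⟨((volume : Measure (Fin 2 → ℝ)).restrict unitSquare).map (fun q => flow e q x),
    ⟨⟨?_⟩, ⟨?_⟩, ?_⟩, ?_⟩
  · rw [happ MeasurableSet.univ]
    simp [volume_unitSquare]
  · intro a B hB
    obtain ⟨p, hp⟩ := exists_flow_eq he a
    have hp' : (fun y : LatticeSpace => a • y) = fun y => flow e p y :=
      funext fun y => (hp y).symm
    have hm : MeasurableSet ((fun y : LatticeSpace => a • y) ⁻¹' B) := by
      rw [hp']
      exact (Continuous.comp (g := fun z : (Fin 2 → ℝ) × LatticeSpace => flow e z.1 z.2)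
        (f := fun y => (p, y)) (continuous_flow e) (by fun_prop)).measurable hB
    rw [happ hm, happ hB, ← (hper B).volume_translate (hcont.measurable hB) p]
    congr 2
    ext q
    change a • flow e q x ∈ B ↔ flow e (p + q) x ∈ B
    rw [← hp, flow_add]
  -- The orbit is the image of the closed unit square, hence compact; this makes its complement
  -- measurable, so `happ` applies.
  · have hsub : MulAction.orbit posDiag x =
        (fun q => flow e q x) '' Set.pi Set.univ fun _ => Set.Icc 0 1 := by
      apply Set.Subset.antisymm
      · rintro _ ⟨a, rfl⟩
        obtain ⟨p, hp⟩ := exists_flow_eq he a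
        refine ⟨fun i => Int.fract (p i), fun i _ =>
          ⟨Int.fract_nonneg _, (Int.fract_lt_one _).le⟩, ?_⟩
        change _ = a • x
        have hn : (fun i => (⌊p i⌋ : ℝ)) ∈ intPlane := (mem_intPlane _).2 fun i => ⟨_, rfl⟩
        rw [← hp, ← hx _ hn]
        change flow e (fun i => Int.fract (p i)) (flow e (fun i => (⌊p i⌋ : ℝ)) x) = _
        rw [← flow_add, hx _ hn]
        congr 1
        funext i
        exact Int.fract_add_floor (p i)
      · rintro _ ⟨q, -, rfl⟩
        exact ⟨expDiag (e q), rfl⟩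
    have hclosed : IsClosed (MulAction.orbit posDiag x) := by
      rw [hsub]
      exact ((isCompact_univ_pi fun _ => isCompact_Icc).image hcont).isClosed
    rw [happ hclosed.measurableSet.compl]
    have : {q | flow e q x ∈ (MulAction.orbit posDiag x)ᶜ} = ∅ :=
      Set.eq_empty_of_forall_notMem fun q hq => hq ⟨expDiag (e q), rfl⟩
    rw [this, Set.empty_inter, measure_empty]
  · intro μ hμ
    refine Measure.ext fun B hB => ?_
    rw [happ hB]
    exact hμ.measure_eq he hB (hper B)

/-! ### A criterion for escape of mass -/

/-- Such an `f` is dominated by the indicator of the complement of the cusp. -/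
lemma integral_le_of_le_cusp {ν : Measure LatticeSpace} [IsProbabilityMeasure ν]
    {f : C_c(LatticeSpace, ℝ)} (hf1 : ∀ x, f x ≤ 1) {δ s : ℝ}
    (hfδ : ∀ x ∈ cusp δ, f x = 0) (h : ENNReal.ofReal s ≤ ν (cusp δ)) :
    ∫ x, f x ∂ν ≤ 1 - s := by
  have hm : MeasurableSet (cusp δ) := (isOpen_cusp δ).measurableSet
  have h1 : ∫ x, f x ∂ν ≤ ∫ x, (cusp δ)ᶜ.indicator (fun _ => (1 : ℝ)) x ∂ν := by
    refine integral_mono (f.continuous.integrable_of_hasCompactSupport f.hasCompactSupport)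
      ((integrable_const _).indicator hm.compl) fun x => ?_
    by_cases hx : x ∈ cusp δ
    · simp [hx, hfδ x hx]
    · simpa [hx] using hf1 x
  rw [integral_indicator hm.compl, setIntegral_const, smul_eq_mul, mul_one,
    probReal_compl_eq_one_sub hm] at h1
  have h2 : s ≤ ν.real (cusp δ) := by
    rw [Measure.real, ← ENNReal.ofReal_le_iff_le_toReal (measure_ne_top _ _)]
    exact h
  linarith

lemma measure_le_of_isWeakStarAccPt {ν : ℕ → Measure LatticeSpace}
    [∀ i, IsProbabilityMeasure (ν i)] {μ : Measure LatticeSpace} (hμ : IsWeakStarAccPt ν μ)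
    {s : ℝ} (h : ∀ δ > 0, ∀ᶠ i in atTop, ENNReal.ofReal s ≤ ν i (cusp δ))
    {C : Set LatticeSpace} (hC : IsCompact C) : μ C ≤ ENNReal.ofReal (1 - s) := by
  have := hμ.locallyFinite
  obtain ⟨f, hfC, -, hfc, hf⟩ := exists_continuous_one_zero_of_isCompact hC
    (isClosed_empty (X := LatticeSpace)) (Set.disjoint_empty C)
  let F : C_c(LatticeSpace, ℝ) := ⟨f, hfc⟩
  have hF (x : LatticeSpace) : F x = f x := rfl
  obtain ⟨δ, hδ, hdisj⟩ := exists_disjoint_cusp_of_isCompact (C := tsupport f) hfc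
  have hle : ∀ᶠ i in atTop, toFunctional (ν i) F ≤ 1 - s := by
    filter_upwards [h δ hδ] with i hi
    refine integral_le_of_le_cusp (fun x => (hf x).2) (fun x hx => ?_) hi
    exact image_eq_zero_of_notMem_tsupport (Set.disjoint_right.1 hdisj hx)
  -- A larger integral would be an open condition in the weak-* topology, hence met by infinitely
  -- many `ν i`, against `hle`.
  have hlim : ∫ x, f x ∂μ ≤ 1 - s := by
    by_contra! hlt
    have hnhds : {φ : C_c(LatticeSpace, ℝ) → ℝ | 1 - s < φ F} ∈ 𝓝 (toFunctional μ) :=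
      (isOpen_lt continuous_const (continuous_apply F)).mem_nhds hlt
    obtain ⟨i, hi, hi'⟩ :=
      ((mapClusterPt_iff_frequently.1 hμ.mapClusterPt _ hnhds).and_eventually hle).exists
    exact (not_lt.2 hi') hi
  have hint : Integrable f μ := f.continuous.integrable_of_hasCompactSupport hfc
  have h1 : μ.real C ≤ ∫ x, f x ∂μ := by
    have h2 : ∫ x in C, f x ∂μ = μ.real C := by
      rw [setIntegral_congr_fun hC.isClosed.measurableSet hfC]
      simp
    rw [← h2]
    exact setIntegral_le_integral hint (Eventually.of_forall fun x => (hf x).1)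
  rw [← ENNReal.ofReal_toReal hC.measure_lt_top.ne]
  exact ENNReal.ofReal_le_ofReal (h1.trans hlim)

lemma escapeOfMass_of_cusp {ν : ℕ → Measure LatticeSpace} [∀ i, IsProbabilityMeasure (ν i)]
    {r : ℝ} (hr : 0 < r)
    (h : ∀ t, 0 < t → t < r → ∀ δ > 0, ∀ᶠ i in atTop,
      ENNReal.ofReal (t ^ 2) ≤ ν i (cusp δ)) : EscapeOfMass (r ^ 2) ν := by
  intro μ hμ
  have hlim : Tendsto (fun t : ℝ => ENNReal.ofReal (1 - t ^ 2)) (𝓝[<] r)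
      (𝓝 (ENNReal.ofReal (1 - r ^ 2))) := by
    refine Tendsto.mono_left (Continuous.tendsto ?_ r) nhdsWithin_le_nhds
    exact ENNReal.continuous_ofReal.comp (by fun_prop)
  refine ge_of_tendsto hlim ?_
  filter_upwards [Ioo_mem_nhdsLT hr] with t ht
  have hmono : Monotone (compactCovering LatticeSpace) :=
    monotone_nat_of_le_succ fun n => compactCovering_subset _ n.le_succ
  rw [← iUnion_compactCovering LatticeSpace, hmono.measure_iUnion]
  exact iSup_le fun n => measure_le_of_isWeakStarAccPt hμ (h t ht.1 ht.2)
    (isCompact_compactCovering LatticeSpace n)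

/-! ### Simplex sets -/

lemma IsSimplexSet.mem_sumZero {Φ : Fin 3 → Fin 3 → ℝ} (h : IsSimplexSet Φ) (j : Fin 3) :
    Φ j ∈ sumZero := h.1 ▸ Submodule.subset_span ⟨j, rfl⟩

lemma IsSimplexSet.third_eq {Φ : Fin 3 → Fin 3 → ℝ} (h : IsSimplexSet Φ) :
    Φ 2 = -Φ 0 - Φ 1 := by
  have h2 := h.2
  rw [Fin.sum_univ_three] at h2
  rw [eq_sub_iff_add_eq, eq_neg_iff_add_eq_zero, ← h2]
  abel

/-- The coordinates on `ℝ³₀` given by the first two vectors of a simplex set. -/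
def IsSimplexSet.plane {Φ : Fin 3 → Fin 3 → ℝ} (h : IsSimplexSet Φ) :
    (Fin 2 → ℝ) →ₗ[ℝ] sumZero :=
  Fintype.linearCombination ℝ ![⟨Φ 0, h.mem_sumZero 0⟩, ⟨Φ 1, h.mem_sumZero 1⟩]

lemma IsSimplexSet.coe_plane {Φ : Fin 3 → Fin 3 → ℝ} (h : IsSimplexSet Φ) (q : Fin 2 → ℝ) :
    (h.plane q : Fin 3 → ℝ) = q 0 • Φ 0 + q 1 • Φ 1 := by
  simp [IsSimplexSet.plane, Fintype.linearCombination_apply]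

lemma IsSimplexSet.plane_surjective {Φ : Fin 3 → Fin 3 → ℝ} (h : IsSimplexSet Φ) :
    Function.Surjective h.plane := by
  intro v
  have hv : (v : Fin 3 → ℝ) ∈ Submodule.span ℝ (Set.range Φ) := by
    rw [h.1]
    exact v.2
  obtain ⟨c, hc⟩ := (Submodule.mem_span_range_iff_exists_fun ℝ).1 hv
  refine ⟨![c 0 - c 2, c 1 - c 2], Subtype.ext ?_⟩
  rw [h.coe_plane, ← hc, Fin.sum_univ_three, h.third_eq]
  ext i
  simp
  ring

/-- If `Φ 0` vanished, `Φ 1` alone would span a plane containing the non-proportional vectors `(1,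
-1, 0)` and `(1, 0, -1)`. This later makes the corresponding unit irrational. -/
lemma IsSimplexSet.first_ne_zero {Φ : Fin 3 → Fin 3 → ℝ} (h : IsSimplexSet Φ) : Φ 0 ≠ 0 := by
  intro h0
  obtain ⟨q, hq⟩ := h.plane_surjective ⟨![1, -1, 0], by
    change ∑ i, (![1, -1, 0] : Fin 3 → ℝ) i = 0
    simp [Fin.sum_univ_three]⟩
  obtain ⟨p, hp⟩ := h.plane_surjective ⟨![1, 0, -1], by
    change ∑ i, (![1, 0, -1] : Fin 3 → ℝ) i = 0
    simp [Fin.sum_univ_three]⟩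
  have hq' := congrArg (fun v : sumZero => (v : Fin 3 → ℝ)) hq
  have hp' := congrArg (fun v : sumZero => (v : Fin 3 → ℝ)) hp
  simp only [h.coe_plane, h0, smul_zero, zero_add] at hq' hp'
  have a1 := congrFun hq' 1
  have a2 := congrFun hq' 2
  have b2 := congrFun hp' 2
  simp only [Pi.smul_apply, smul_eq_mul, Matrix.cons_val] at a1 a2 b2
  rcases mul_eq_zero.1 a2 with h | h <;> simp [h] at a1 b2

lemma mem_hexVertices (Φ : Fin 3 → Fin 3 → ℝ) {a b c : ℝ} (h : ({a, b, c} : Set ℝ) = {0, 1 / 3, 2 / 3}) :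
    a • Φ 0 + b • Φ 1 + c • Φ 2 ∈ hexVertices Φ := by
  refine ⟨![a, b, c], ?_, by simp [Fin.sum_univ_three]⟩
  rw [← h]
  ext x
  simp [eq_comm]
  tauto

lemma le_ceilSet_hexVertices {Φ : Fin 3 → Fin 3 → ℝ} {v : Fin 3 → ℝ} (hv : v ∈ hexVertices Φ)
    (i : Fin 3) : v i ≤ ceilSet (hexVertices Φ) := by
  -- The crude bound, valid because the coefficients lie in `[0, 1]`, ensures that `sSup` is a
  -- genuine supremum.
  refine le_csSup ⟨∑ k, ∑ j, |Φ j k|, ?_⟩ ⟨v, hv, i, rfl⟩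
  rintro _ ⟨_, ⟨l, hl, rfl⟩, k, rfl⟩
  have h1 : ∑ j, |Φ j k| ≤ ∑ k, ∑ j, |Φ j k| :=
    Finset.single_le_sum (f := fun k => ∑ j, |Φ j k|)
      (fun k _ => Finset.sum_nonneg fun j _ => abs_nonneg _) (Finset.mem_univ k)
  refine le_trans ?_ h1
  rw [Finset.sum_apply]
  refine Finset.sum_le_sum fun j _ => ?_
  have hj : l j ∈ ({0, 1 / 3, 2 / 3} : Set ℝ) := hl ▸ Set.mem_range_self j
  have hlj : 0 ≤ l j ∧ l j ≤ 1 := by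
    rcases hj with h | h | h <;> rw [h] <;> norm_num
  rw [Pi.smul_apply, smul_eq_mul]
  calc l j * Φ j k ≤ l j * |Φ j k| := mul_le_mul_of_nonneg_left (le_abs_self _) hlj.1
    _ ≤ |Φ j k| := mul_le_of_le_one_left (abs_nonneg _) hlj.2

/-- The coordinates of the six vertices are bounded by `⌈W_Φ⌉`. -/
lemma IsSimplexSet.vertex_le {Φ : Fin 3 → Fin 3 → ℝ} (h : IsSimplexSet Φ) (i : Fin 3) :
    |(2 * Φ 0 i + Φ 1 i) / 3| ≤ ceilSet (hexVertices Φ) ∧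
    |(Φ 0 i + 2 * Φ 1 i) / 3| ≤ ceilSet (hexVertices Φ) ∧
    |(Φ 0 i - Φ 1 i) / 3| ≤ ceilSet (hexVertices Φ) := by
  have key {a b c : ℝ} (hs : ({a, b, c} : Set ℝ) = {0, 1 / 3, 2 / 3}) :
      a * Φ 0 i + b * Φ 1 i + c * (-Φ 0 i - Φ 1 i) ≤ ceilSet (hexVertices Φ) := by
    have := le_ceilSet_hexVertices (mem_hexVertices Φ hs) i
    rw [h.third_eq] at this
    exact this
  -- The six permutations form three pairs of opposite vertices, which supply both signs of each
  -- absolute value.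
  have k1 := key (a := 2 / 3) (b := 1 / 3) (c := 0) (by ext x; simp; tauto)
  have k2 := key (a := 1 / 3) (b := 2 / 3) (c := 0) (by ext x; simp; tauto)
  have k3 := key (a := 0) (b := 1 / 3) (c := 2 / 3) rfl
  have k4 := key (a := 1 / 3) (b := 0) (c := 2 / 3) (by ext x; simp; tauto)
  have k5 := key (a := 2 / 3) (b := 0) (c := 1 / 3) (by ext x; simp; tauto)
  have k6 := key (a := 0) (b := 2 / 3) (c := 1 / 3) (by ext x; simp; tauto)
  simp only [abs_le]
  refine ⟨⟨?_, ?_⟩, ⟨?_, ?_⟩, ?_, ?_⟩ <;> linarith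

lemma IsSimplexSet.first_le {Φ : Fin 3 → Fin 3 → ℝ} (h : IsSimplexSet Φ) (i : Fin 3) :
    Φ 0 i ≤ 2 * ceilSet (hexVertices Φ) := by
  obtain ⟨h1, -, h3⟩ := h.vertex_le i
  have := le_abs_self ((2 * Φ 0 i + Φ 1 i) / 3)
  -- `Φ 0` is the sum of the two vertices `(2 Φ 0 + Φ 1) / 3` and `(Φ 0 - Φ 1) / 3`.
  have := le_abs_self ((Φ 0 i - Φ 1 i) / 3)
  linarith

/-- A linear form on a hexagon is maximal at a vertex. In the coordinates `(a, b)` the vertices are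
`±(t, 0)`, `±(0, t)`, `±(t, -t)`, with values `±t P`, `±t Q`, `±t (P - Q)`. -/
lemma mul_add_mul_le_of_hexagon {a b P Q t w : ℝ} (ha : |a| ≤ t) (hb : |b| ≤ t)
    (hab : |a + b| ≤ t) (hP : |P| ≤ w) (hQ : |Q| ≤ w) (hPQ : |P - Q| ≤ w) :
    a * P + b * Q ≤ t * w := by
  have hw : 0 ≤ w := (abs_nonneg _).trans hP
  rw [abs_le] at *
  rcases le_total 0 a with h1 | h1 <;> rcases le_total 0 b with h2 | h2
  · nlinarith
  · rcases le_total 0 (a + b) with h3 | h3 <;> nlinarith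
  · rcases le_total 0 (a + b) with h3 | h3 <;> nlinarith
  · nlinarith

lemma IsSimplexSet.plane_le {Φ : Fin 3 → Fin 3 → ℝ} (h : IsSimplexSet Φ) {t : ℝ}
    {q : Fin 2 → ℝ} (hq : q ∈ hexagon t) (i : Fin 3) :
    (h.plane q : Fin 3 → ℝ) i ≤ t * ceilSet (hexVertices Φ) := by
  obtain ⟨h1, h2, h3⟩ := h.vertex_le i
  obtain ⟨q1, q2, q3⟩ := hq
  -- With `a = 2 q 0 - q 1`, `b = 2 q 1 - q 0` and the vertices `P`, `Q` from `vertex_le`, the sum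
  -- `a P + b Q` equals `q 0 Φ 0 + q 1 Φ 1`.
  have := mul_add_mul_le_of_hexagon q1 q2 (by convert q3 using 2; ring) h1 h2
    (by convert h3 using 2; ring)
  rw [h.coe_plane]
  simp only [Pi.add_apply, Pi.smul_apply, smul_eq_mul]
  linarith

/-! ### Units acting on the lattice of a full module -/

lemma coe_mul_units_order (M : FullModule K) (u v : M.orderˣ) :
    (((u * v : M.orderˣ) : M.order) : K) = ((u : M.order) : K) * ((v : M.order) : K) := rfl

lemma unit_ne_zero (M : FullModule K) (u : M.orderˣ) : ((u : M.order) : K) ≠ 0 := by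
  intro h
  have h1 := coe_mul_units_order M u u⁻¹
  rw [mul_inv_cancel, h, zero_mul] at h1
  exact one_ne_zero h1

lemma psi_mul_units (M : FullModule K) (σ : Fin 3 ≃ (K →+* ℝ)) (u v : M.orderˣ) :
    psi σ (((u * v : M.orderˣ) : M.order) : K) =
      psi σ ((u : M.order) : K) + psi σ ((v : M.order) : K) := by
  funext i
  rw [coe_mul_units_order, Pi.add_apply, psi, psi, psi, map_mul, abs_mul, Real.log_mul]
  · exact abs_ne_zero.2 ((map_ne_zero _).2 (unit_ne_zero M u))
  · exact abs_ne_zero.2 ((map_ne_zero _).2 (unit_ne_zero M v))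

/-- The unit lattice as an additive group. -/
def FullModule.logUnitsHom (M : FullModule K) (σ : Fin 3 ≃ (K →+* ℝ)) :
    Additive M.orderˣ →+ (Fin 3 → ℝ) :=
  AddMonoidHom.mk' (fun u => psi σ ((u.toMul : M.order) : K)) fun _ _ => psi_mul_units M σ _ _

lemma exp_psi_unit (M : FullModule K) (σ : Fin 3 ≃ (K →+* ℝ)) (u : M.orderˣ) (i : Fin 3) :
    Real.exp (psi σ ((u : M.order) : K) i) = |σ i ((u : M.order) : K)| := by
  rw [psi, Real.exp_log]
  exact abs_pos.2 ((map_ne_zero _).2 (unit_ne_zero M u))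

lemma FullModule.mul_mem_lattice (M : FullModule K) (σ : Fin 3 ≃ (K →+* ℝ)) (u : M.order)
    {w : Fin 3 → ℝ} (hw : w ∈ M.lattice σ) : (fun i => σ i (u : K) * w i) ∈ M.lattice σ := by
  obtain ⟨_, ⟨m, hm, rfl⟩, rfl⟩ := hw
  refine ⟨_, ⟨(u : K) * m, u.2 m hm, rfl⟩, ?_⟩
  funext i
  simp [phi]
  ring

/-- The squares of units stabilize the lattice. -/
lemma FullModule.expDiag_two_smul_point (M : FullModule K) (σ : Fin 3 ≃ (K →+* ℝ))
    {v : sumZero} (hv : (v : Fin 3 → ℝ) ∈ M.logUnits σ) :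
    expDiag ((2 : ℝ) • v) • M.point σ = M.point σ := by
  -- If `v = ψ(u)`, then `exp (2 v)` is multiplication by `u ^ 2`; squaring removes the signs of the
  -- embeddings of `u`.
  have hle : ∀ v : sumZero, (v : Fin 3 → ℝ) ∈ M.logUnits σ →
      toLattice (expDiag ((2 : ℝ) • v) • M.point σ) ≤ toLattice (M.point σ) := by
    rintro v ⟨u, hu⟩
    rw [posDiag_smul, toLattice_smul, M.toLattice_point]
    rintro _ ⟨w, hw, rfl⟩
    convert M.mul_mem_lattice σ (u : M.order) (M.mul_mem_lattice σ (u : M.order) hw) using 1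
    rw [actMap_expDiag]
    funext i
    have : Real.exp ((v : Fin 3 → ℝ) i) = |σ i ((u : M.order) : K)| := by
      rw [← hu]
      exact exp_psi_unit M σ u i
    rw [Submodule.coe_smul, Pi.smul_apply, smul_eq_mul, two_mul, Real.exp_add, this,
      abs_mul_abs_self, mul_assoc]
  refine toLattice_injective (le_antisymm (hle v hv) ?_)
  have h1 := hle (-v) ((M.logUnitsHom σ).range.neg_mem hv)
  have h2 := Submodule.map_mono (f := actMap (expDiag ((2 : ℝ) • v))) h1
  rwa [← toLattice_smul, ← toLattice_smul, ← posDiag_smul, ← posDiag_smul, ← mul_smul,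
    ← expDiag_add, smul_neg, add_neg_cancel, expDiag_zero, one_smul] at h2

lemma norm_toLp_le_of_abs_le {v w : Fin 3 → ℝ} {c : ℝ} (hc : 0 ≤ c)
    (h : ∀ i, |v i| ≤ c * |w i|) : ‖WithLp.toLp 2 v‖ ≤ c * ‖WithLp.toLp 2 w‖ := by
  rw [EuclideanSpace.norm_eq, EuclideanSpace.norm_eq, ← Real.sqrt_sq hc, ← Real.sqrt_mul (sq_nonneg c),
    Finset.mul_sum]
  refine Real.sqrt_le_sqrt (Finset.sum_le_sum fun i _ => ?_)
  rw [← mul_pow]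
  exact pow_le_pow_left₀ (abs_nonneg _) (h i) 2

/-- The depth in the cusp is invariant under the unit lattice. -/
lemma FullModule.expDiag_add_smul_point_mem_cusp (M : FullModule K) (σ : Fin 3 ≃ (K →+* ℝ))
    {v : sumZero} (hv : (v : Fin 3 → ℝ) ∈ M.logUnits σ) (w : sumZero) (δ : ℝ) :
    expDiag (v + w) • M.point σ ∈ cusp δ ↔ expDiag w • M.point σ ∈ cusp δ := by
  have key : ∀ v w : sumZero, (v : Fin 3 → ℝ) ∈ M.logUnits σ →
      expDiag w • M.point σ ∈ cusp δ → expDiag (v + w) • M.point σ ∈ cusp δ := by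
    rintro v w hv ⟨_, hz, h0, hn⟩
    obtain ⟨u, hu⟩ := (M.logUnitsHom σ).range.neg_mem hv
    rw [posDiag_smul, toLattice_smul, M.toLattice_point] at hz
    obtain ⟨z, hz, rfl⟩ := hz
    have huv : ∀ i, Real.exp ((v : Fin 3 → ℝ) i) * |σ i ((u.toMul : M.order) : K)| = 1 := by
      intro i
      have h1 : psi σ ((u.toMul : M.order) : K) = -(v : Fin 3 → ℝ) := hu
      rw [← exp_psi_unit M σ u.toMul, h1, ← Real.exp_add]
      simp
    -- With `ψ(u) = -v`, replacing the lattice vector `z` by `u z` undoes the factor `exp v` up to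
    -- sign in each coordinate, so the norm is unchanged.
    have habs : ∀ i, |actMap (expDiag (v + w)) (fun i => σ i ((u.toMul : M.order) : K) * z i) i| =
        |actMap (expDiag w) z i| := by
      intro i
      rw [actMap_expDiag, actMap_expDiag]
      simp only [Submodule.coe_add, Pi.add_apply, Real.exp_add, abs_mul, Real.abs_exp]
      linear_combination (Real.exp ((w : Fin 3 → ℝ) i) * |z i|) * huv i
    refine ⟨actMap (expDiag (v + w)) (fun i => σ i ((u.toMul : M.order) : K) * z i), ?_, ?_, ?_⟩
    · rw [posDiag_smul, toLattice_smul, M.toLattice_point]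
      exact ⟨_, M.mul_mem_lattice σ _ hz, rfl⟩
    · intro h
      refine h0 (funext fun i => ?_)
      have := habs i
      rw [h] at this
      simpa using this.symm
    · refine lt_of_le_of_lt ?_ hn
      simpa using norm_toLp_le_of_abs_le zero_le_one fun i => (habs i).le.trans (one_mul _).ge
  refine ⟨fun h => ?_, key v w hv⟩
  have := key (-v) (v + w) ((M.logUnitsHom σ).range.neg_mem hv) h
  rwa [neg_add_cancel_left] at this

/-! ### Tight simplex sets -/

namespace IsTight

variable {M : FullModule K} {σ : Fin 3 ≃ (K →+* ℝ)} {R r : ℝ} {Φ : Fin 3 → Fin 3 → ℝ}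

lemma plane_mem_logUnits (h : IsTight M σ R r Φ) {n : Fin 2 → ℝ} (hn : n ∈ intPlane) :
    (h.isSimplexSet.plane n : Fin 3 → ℝ) ∈ M.logUnits σ := by
  obtain ⟨a, ha⟩ := (mem_intPlane n).1 hn 0
  obtain ⟨b, hb⟩ := (mem_intPlane n).1 hn 1
  rw [h.isSimplexSet.coe_plane, ← ha, ← hb, Int.cast_smul_eq_zsmul, Int.cast_smul_eq_zsmul]
  exact (M.logUnitsHom σ).range.add_mem
    ((M.logUnitsHom σ).range.zsmul_mem (h.mem_logUnits 0) a)
    ((M.logUnitsHom σ).range.zsmul_mem (h.mem_logUnits 1) b)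

/-- The factor 2 passes to squares of units, which stabilize the point exactly. -/
lemma existsUnique_isPeriodicMeasure (h : IsTight M σ R r Φ) :
    ∃! μ : Measure LatticeSpace, IsPeriodicMeasure (M.point σ) μ := by
  refine CubicOrbit.existsUnique_isPeriodicMeasure (e := (2 : ℝ) • h.isSimplexSet.plane) ?_
    fun n hn => M.expDiag_two_smul_point σ (h.plane_mem_logUnits hn)
  intro v
  obtain ⟨q, hq⟩ := h.isSimplexSet.plane_surjective ((2 : ℝ)⁻¹ • v)
  exact ⟨q, by simp [hq]⟩

/-- No factor 2 is needed here, so the density may be measured against the hexagon of `Φ` itself. -/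
lemma isPeriodicSet_cusp (h : IsTight M σ R r Φ) (δ : ℝ) :
    IsPeriodicSet {q | flow h.isSimplexSet.plane q (M.point σ) ∈ cusp δ} := by
  intro n hn q
  change expDiag (h.isSimplexSet.plane (n + q)) • M.point σ ∈ cusp δ ↔ _
  rw [map_add]
  exact M.expDiag_add_smul_point_mem_cusp σ (h.plane_mem_logUnits hn) _ δ

/-- A tight lattice has a short vector. -/
lemma exists_short (h : IsTight M σ R r Φ) (hR : 0 < R) :
    ∃ v ∈ toLattice (M.point σ), v ≠ 0 ∧
      ‖WithLp.toLp 2 v‖ < 2 * R * Real.exp (-(r * ceilSet (hexVertices Φ))) := by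
  have h1 := h.exp_le
  rw [height] at h1
  set S := {t : ℝ | ∃ v ∈ toLattice (M.point σ), v ≠ 0 ∧ t = ‖WithLp.toLp 2 v‖} with hS
  set c := r * ceilSet (hexVertices Φ)
  -- Tightness forces a positive height. With the conventions `0⁻¹ = 0` and `sInf ∅ = 0`, this also
  -- shows that `S` is nonempty.
  have hpos : 0 < sInf S := by
    by_contra! hneg
    have := mul_nonpos_of_nonpos_of_nonneg (inv_nonpos.2 hneg) hR.le
    linarith [Real.exp_pos c]
  have hne : S.Nonempty := by
    by_contra hne
    rw [Set.not_nonempty_iff_eq_empty.1 hne, Real.sInf_empty] at hpos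
    exact lt_irrefl _ hpos
  have h2 : sInf S ≤ R * Real.exp (-c) := by
    rw [inv_mul_eq_div, le_div_iff₀ hpos] at h1
    rw [Real.exp_neg, ← div_eq_mul_inv, le_div_iff₀ (Real.exp_pos c)]
    linarith
  have h3 : 0 < R * Real.exp (-c) := mul_pos hR (Real.exp_pos _)
  -- The factor 2 leaves room above the infimum, so its attainment is not needed.
  obtain ⟨_, ⟨v, hv, h0, rfl⟩, hlt⟩ := exists_lt_of_csInf_lt hne
    (show sInf S < 2 * R * Real.exp (-c) by linarith)
  exact ⟨v, hv, h0, hlt⟩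

lemma hexagon_subset (h : IsTight M σ R r Φ) (hR : 0 < R) {t δ : ℝ}
    (hδ : 2 * R * Real.exp ((t - r) * ceilSet (hexVertices Φ)) ≤ δ) :
    hexagon t ⊆ {q | flow h.isSimplexSet.plane q (M.point σ) ∈ cusp δ} := by
  intro q hq
  obtain ⟨v, hv, h0, hn⟩ := h.exists_short hR
  set w := ceilSet (hexVertices Φ)
  change expDiag (h.isSimplexSet.plane q) • M.point σ ∈ cusp δ
  refine ⟨actMap (expDiag (h.isSimplexSet.plane q)) v, ?_, ?_, ?_⟩
  · rw [posDiag_smul, toLattice_smul]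
    exact ⟨v, hv, rfl⟩
  · rw [actMap_expDiag]
    intro h1
    refine h0 (funext fun i => ?_)
    simpa using congrFun h1 i
  · have h1 : ‖WithLp.toLp 2 (actMap (expDiag (h.isSimplexSet.plane q)) v)‖ ≤
        Real.exp (t * w) * ‖WithLp.toLp 2 v‖ := by
      refine norm_toLp_le_of_abs_le (Real.exp_pos _).le fun i => ?_
      rw [actMap_expDiag, abs_mul, Real.abs_exp]
      exact mul_le_mul_of_nonneg_right (Real.exp_le_exp.2 (h.isSimplexSet.plane_le hq i))
        (abs_nonneg _)
    calc _ ≤ Real.exp (t * w) * ‖WithLp.toLp 2 v‖ := h1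
      _ < Real.exp (t * w) * (2 * R * Real.exp (-(r * w))) :=
        mul_lt_mul_of_pos_left hn (Real.exp_pos _)
      _ = 2 * R * Real.exp ((t - r) * w) := by
        rw [mul_left_comm, ← Real.exp_add]
        ring_nf
      _ ≤ δ := hδ

/-- The periodic measure of a tight lattice has much mass in the cusp. -/
lemma le_measure_cusp (h : IsTight M σ R r Φ) (hR : 0 < R) {t δ : ℝ} (ht : 0 < t) (ht1 : t < 1)
    (hδ : 2 * R * Real.exp ((t - r) * ceilSet (hexVertices Φ)) ≤ δ)
    {μ : Measure LatticeSpace} (hμ : IsPeriodicMeasure (M.point σ) μ) :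
    ENNReal.ofReal (t ^ 2) ≤ μ (cusp δ) := by
  rw [hμ.measure_eq h.isSimplexSet.plane_surjective (isOpen_cusp δ).measurableSet
    (h.isPeriodicSet_cusp δ)]
  exact (h.isPeriodicSet_cusp δ).le_volume ht ht1 (h.hexagon_subset hR hδ)

end IsTight

/-! ### Finiteness of the orders with a small unit -/

/-- The determinant trick: `a` maps a nonzero finitely generated subgroup of a field into itself. -/
lemma FullModule.isIntegral_of_mem_order (M : FullModule K) {a : K} (ha : a ∈ M.order) :
    IsIntegral ℤ a := by
  refine isIntegral_of_smul_mem_submodule M.toSubmodule ?_ ?_ a ha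
  · intro h
    have h1 := M.span_rat
    rw [h] at h1
    simp at h1
  · obtain ⟨α, hα⟩ := M.exists_generators
    rw [hα]
    exact Submodule.fg_span (Set.finite_range α)

/-- Finitely many subrings lie between a finitely generated group and its fractions of bounded
denominator. -/
lemma finite_subrings_of_mul_mem {F : Type*} [Field F] [CharZero F] {N : Submodule ℤ F}
    (hN : N.FG) {D : ℕ} (hD : D ≠ 0) :
    {S : Subring F | (∀ x ∈ N, x ∈ S) ∧ ∀ s ∈ S, (D : F) * s ∈ N}.Finite := by
  obtain ⟨n, g, hg⟩ := Submodule.fg_iff_exists_fin_generating_family.1 hN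
  have hDF : (D : F) ≠ 0 := Nat.cast_ne_zero.2 hD
  -- `T` contains representatives of `D⁻¹ N` modulo `N`. Since `N ⊆ S ⊆ D⁻¹ N`, the ring `S` is
  -- determined by `S ∩ T`; division of coefficients by `D` with remainder splits `s` as `t + y`.
  set T : Set F := Set.range fun c : Fin n → Fin D => (∑ k, ((c k : ℕ) : ℤ) • g k) / (D : F) with hT
  have hTfin : T.Finite := Set.finite_range _
  refine Set.Finite.of_finite_image (f := fun S : Subring F => (S : Set F) ∩ T)
    (hTfin.finite_subsets.subset ?_) ?_
  · rintro _ ⟨S, -, rfl⟩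
    exact Set.inter_subset_right
  · have key : ∀ S₁ S₂ : Subring F, (∀ s ∈ S₁, (D : F) * s ∈ N) → (∀ x ∈ N, x ∈ S₁) →
        (∀ x ∈ N, x ∈ S₂) → (S₁ : Set F) ∩ T = (S₂ : Set F) ∩ T → S₁ ≤ S₂ := by
      intro S₁ S₂ h1 h1' h2 he s hs
      have hsN := h1 s hs
      rw [← hg] at hsN
      obtain ⟨z, hz⟩ := (Submodule.mem_span_range_iff_exists_fun ℤ).1 hsN
      have hDpos : (0 : ℤ) < D := by exact_mod_cast Nat.pos_of_ne_zero hD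
      have hc (k : Fin n) : (z k % D).toNat < D := by
        have := Int.emod_lt_of_pos (z k) hDpos
        have := Int.emod_nonneg (z k) hDpos.ne'
        omega
      set t : F := (∑ k, ((((⟨(z k % D).toNat, hc k⟩ : Fin D) : ℕ) : ℤ) • g k)) / (D : F) with ht
      have htT : t ∈ T := ⟨fun k => ⟨(z k % D).toNat, hc k⟩, rfl⟩
      set y : F := ∑ k, (z k / D) • g k with hy
      have hyN : y ∈ N := by
        rw [← hg]
        exact Submodule.sum_mem _ fun k _ =>
          Submodule.smul_mem _ _ (Submodule.subset_span ⟨k, rfl⟩)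
      have hst : s = t + y := by
        apply mul_left_cancel₀ hDF
        rw [mul_add, ht, mul_div_cancel₀ _ hDF, hy, Finset.mul_sum, ← Finset.sum_add_distrib, ← hz]
        refine Finset.sum_congr rfl fun k _ => ?_
        have h3 : (((z k % D).toNat : ℕ) : ℤ) = z k % D :=
          Int.toNat_of_nonneg (Int.emod_nonneg (z k) hDpos.ne')
        simp only [h3]
        have h4 : ((z k : ℤ) : F) = ((z k % D : ℤ) : F) + (D : F) * ((z k / D : ℤ) : F) := by
          exact_mod_cast congrArg (Int.cast : ℤ → F) (Int.emod_add_mul_ediv (z k) D).symm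
        rw [zsmul_eq_mul, zsmul_eq_mul, zsmul_eq_mul, h4]
        ring
      have htS : t ∈ (S₁ : Set F) ∩ T := by
        refine ⟨?_, htT⟩
        rw [show t = s - y by rw [hst, add_sub_cancel_right]]
        exact sub_mem hs (h1' y hyN)
      rw [he] at htS
      rw [hst]
      exact add_mem htS.1 (h2 y hyN)
    intro S₁ h1 S₂ h2 he
    exact le_antisymm (key S₁ S₂ h1.2 h1.1 h2.1 he) (key S₂ S₁ h2.2 h2.1 h1.1 he.symm)

/-- The discriminant of the power basis serves as a common denominator. -/
lemma exists_int_mul_mem_adjoin {L : Type*} [Field L] [Algebra ℚ L] [FiniteDimensional ℚ L]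
    {B : PowerBasis ℚ L} (hB : IsIntegral ℤ B.gen) :
    ∃ d : ℤ, d ≠ 0 ∧ ∀ z : L, IsIntegral ℤ z → d • z ∈ Algebra.adjoin ℤ {B.gen} := by
  have hbI (i) : IsIntegral ℤ (B.basis i) := by
    rw [B.basis_eq_pow]
    exact hB.pow _
  obtain ⟨d, hd⟩ := IsIntegrallyClosed.isIntegral_iff.1 (Algebra.discr_isIntegral ℚ hbI)
  refine ⟨d, ?_, fun z hz => ?_⟩
  · rintro rfl
    exact Algebra.discr_not_zero_of_basis ℚ B.basis (by rw [← hd, map_zero])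
  · have h1 := Algebra.discr_mul_isIntegral_mem_adjoin ℚ hB hz
    rwa [← hd, algebraMap_smul] at h1

/-- Finitely many rings of integral elements of `ℚ(u)` contain `u`. -/
lemma finite_integral_subrings {F : Type*} [Field F] [CharZero F] {u : F} (hu : IsIntegral ℤ u) :
    {S : Subring F | u ∈ S ∧ ∀ s ∈ S, IsIntegral ℤ s ∧ s ∈ IntermediateField.adjoin ℚ {u}}.Finite := by
  have huQ : IsIntegral ℚ u := hu.tower_top
  let B := IntermediateField.adjoin.powerBasis huQ
  have hgen : B.gen = IntermediateField.AdjoinSimple.gen ℚ u :=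
    IntermediateField.adjoin.powerBasis_gen huQ
  have : FiniteDimensional ℚ (IntermediateField.adjoin ℚ {u}) :=
    IntermediateField.adjoin.finiteDimensional huQ
  have hgenI : IsIntegral ℤ B.gen := by
    rw [hgen, ← IntermediateField.coe_isIntegral_iff]
    simpa using hu
  obtain ⟨d, hd0, hd⟩ := exists_int_mul_mem_adjoin hgenI
  refine (finite_subrings_of_mul_mem (N := Subalgebra.toSubmodule (Algebra.adjoin ℤ {u}))
    hu.fg_adjoin_singleton (Int.natAbs_ne_zero.2 hd0)).subset ?_
  rintro S ⟨huS, hS⟩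
  constructor
  · have : Algebra.adjoin ℤ {u} ≤ subalgebraOfSubring S :=
      Algebra.adjoin_le (Set.singleton_subset_iff.2 huS)
    exact fun x hx => this hx
  · intro s hs
    obtain ⟨hsI, hsu⟩ := hS s hs
    have h1 := hd (⟨s, hsu⟩ : IntermediateField.adjoin ℚ {u})
      (by rw [← IntermediateField.coe_isIntegral_iff]; exact hsI)
    have h2 : (d : F) * s ∈ Algebra.adjoin ℤ {u} := by
      have h3 := (Subalgebra.mem_map (f := (IntermediateField.val
        (IntermediateField.adjoin ℚ {u})).restrictScalars ℤ)).2 ⟨_, h1, rfl⟩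
      rw [AlgHom.map_adjoin, Set.image_singleton, hgen] at h3
      rw [map_zsmul, zsmul_eq_mul] at h3
      exact h3
    change ((d.natAbs : ℕ) : F) * s ∈ Algebra.adjoin ℤ {u}
    rcases Int.natAbs_eq d with h | h
    · rw [h] at h2
      simpa using h2
    · rw [h] at h2
      simpa using neg_mem h2

/-- Finitely many algebraic integers of bounded degree have bounded conjugates. -/
lemma finite_integers_of_norm_le {F : Type*} [Field F] [CharZero F] (n : ℕ) (B : ℝ) :
    {x : F | IsIntegral ℤ x ∧ ∃ (L : Subfield F) (_ : NumberField L) (y : L), (y : F) = x ∧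
      Module.finrank ℚ L = n ∧ ∀ φ : L →+* ℂ, ‖φ y‖ ≤ B}.Finite := by
  classical
  -- `C` bounds the coefficients of the minimal polynomial, which are symmetric functions of the
  -- conjugates. Counting roots in `F` handles all subfields `L` at once.
  let C := Nat.ceil (max B 1 ^ n * n.choose (n / 2))
  refine (Polynomial.bUnion_roots_finite (algebraMap ℤ F) n
    (Set.finite_Icc (-C : ℤ) C)).subset ?_
  rintro _ ⟨hx, L, _, y, rfl, hn, hy⟩
  have hyI : IsIntegral ℤ y :=
    (isIntegral_algHom_iff (L.subtype.toIntAlgHom) Subtype.val_injective).1 hx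
  have hmin := minpoly.isIntegrallyClosed_eq_field_fractions' ℚ hyI
  have hmem : (y : F) ∈ (minpoly ℤ y).rootSet F := by
    refine Polynomial.mem_rootSet.2 ⟨minpoly.ne_zero hyI, ?_⟩
    have := Polynomial.aeval_algHom_apply L.subtype.toIntAlgHom y (minpoly ℤ y)
    rw [minpoly.aeval, map_zero] at this
    exact this
  refine Set.mem_iUnion₂.2 ⟨minpoly ℤ y, ⟨?_, fun i => ?_⟩, hmem⟩
  · rw [← (minpoly.monic hyI).natDegree_map (algebraMap ℤ ℚ), ← hmin, ← hn]
    exact minpoly.natDegree_le y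
  · rw [Set.mem_Icc, ← abs_le, ← @Int.cast_le ℝ]
    have h1 := NumberField.Embeddings.coeff_bdd_of_norm_le hy i
    rw [hn] at h1
    refine (Eq.trans_le ?_ h1).trans (Nat.le_ceil _)
    rw [hmin, Polynomial.coeff_map, eq_intCast, Int.norm_cast_rat, Int.norm_eq_abs, Int.cast_abs]

/-- An element outside `ℚ` generates a cubic field. -/
lemma mem_adjoin_of_finrank_prime {F : Type*} [Field F] [CharZero F] {L : Subfield F}
    (hL : (Module.finrank ℚ L).Prime) {y : L} (hy : ∀ q : ℚ, (q : L) ≠ y) (z : L) :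
    (z : F) ∈ IntermediateField.adjoin ℚ {(y : F)} := by
  have := IntermediateField.isSimpleOrder_of_finrank_prime ℚ L hL
  have htop : IntermediateField.adjoin ℚ {y} = ⊤ := by
    refine (eq_bot_or_eq_top _).resolve_left fun hbot => ?_
    obtain ⟨q, hq⟩ := IntermediateField.mem_bot.1
      (IntermediateField.adjoin_simple_eq_bot_iff.1 hbot)
    exact hy q (by rw [← hq, eq_ratCast])
  have hz : z ∈ IntermediateField.adjoin ℚ {y} := htop ▸ IntermediateField.mem_top
  have h1 := (IntermediateField.mem_map (f := L.subtype.toRatAlgHom) _).2 ⟨z, hz, rfl⟩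
  rw [IntermediateField.adjoin_map, Set.image_singleton] at h1
  exact h1

namespace IsTight

variable {M : FullModule K} {σ : Fin 3 ≃ (K →+* ℝ)} {R r : ℝ} {Φ : Fin 3 → Fin 3 → ℝ}

/-- The order of a tight module has an irrational element with bounded conjugates. -/
lemma exists_bounded_irrational (h : IsTight M σ R r Φ) : ∃ y ∈ M.order,
    (∀ q : ℚ, (q : K) ≠ y) ∧ ∀ j, |σ j y| ≤ Real.exp (2 * ceilSet (hexVertices Φ)) := by
  obtain ⟨u, hu⟩ := h.mem_logUnits 0
  have hu' : psi σ ((u : M.order) : K) = Φ 0 := hu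
  refine ⟨((u : M.order) : K), (u : M.order).2, fun q hq => h.isSimplexSet.first_ne_zero ?_,
    fun j => ?_⟩
  -- For a rational unit all three logarithms agree; as their sum is zero, each vanishes.
  · have hs := sum_eq_zero_of_mem_sumZero (h.isSimplexSet.mem_sumZero 0)
    rw [← hu', ← hq] at hs ⊢
    simp only [psi, map_ratCast, Fin.sum_univ_three] at hs ⊢
    funext i
    rw [psi, map_ratCast, Pi.zero_apply]
    linarith
  · rw [← exp_psi_unit M σ u j, hu']
    exact Real.exp_le_exp.2 (h.isSimplexSet.first_le j)

end IsTight

/-- The simplex sets of tight modules with distinct orders grow. -/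
lemma tendsto_ceilSet {Ω : Type*} [Field Ω] [CharZero Ω] {R r : ℝ} (K : ℕ → Subfield Ω)
    [∀ i, NumberField (K i)] [∀ i, NumberField.IsTotallyReal (K i)]
    (hK : ∀ i, Module.finrank ℚ (K i) = 3) (σ : ∀ i, Fin 3 ≃ (K i →+* ℝ))
    (M : ∀ i, FullModule (K i)) (hM : Function.Injective fun i => (M i).order.map (K i).subtype)
    (Φ : ℕ → Fin 3 → Fin 3 → ℝ) (hΦ : ∀ i, IsTight (M i) (σ i) R r (Φ i)) :
    Tendsto (fun i => ceilSet (hexVertices (Φ i))) atTop atTop := by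
  refine tendsto_atTop.2 fun C => ?_
  -- The indices with small `ceilSet` inject, through their distinct orders, into a finite set of
  -- subrings of `Ω`.
  rw [← Nat.cofinite_eq_atTop, Filter.eventually_cofinite]
  have hU := finite_integers_of_norm_le (F := Ω) 3 (Real.exp (2 * C))
  refine ((hU.biUnion fun u hu => finite_integral_subrings hu.1).preimage hM.injOn).subset ?_
  intro i hi
  have hi' : ceilSet (hexVertices (Φ i)) < C := not_le.1 hi
  obtain ⟨y, hyM, hyQ, hy⟩ := (hΦ i).exists_bounded_irrational
  have hint {a : K i} (ha : a ∈ (M i).order) : IsIntegral ℤ (a : Ω) :=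
    ((M i).isIntegral_of_mem_order ha).map (K i).subtype.toIntAlgHom
  refine Set.mem_iUnion₂.2 ⟨(y : Ω), ⟨hint hyM, K i, inferInstance, y, rfl, hK i, fun φ => ?_⟩,
    ⟨y, hyM, rfl⟩, ?_⟩
  -- By total reality every complex embedding is one of the `σ i j`, so the bound on real conjugates
  -- suffices.
  · have hφ := NumberField.IsTotallyReal.complexEmbedding_isReal φ
    obtain ⟨j, hj⟩ := (σ i).surjective hφ.embedding
    have h1 : φ y = ((σ i j y : ℝ) : ℂ) := by
      rw [hj, NumberField.ComplexEmbedding.IsReal.coe_embedding_apply]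
    rw [h1, Complex.norm_real, Real.norm_eq_abs]
    refine (hy j).trans (Real.exp_le_exp.2 ?_)
    linarith
  · rintro _ ⟨a, ha, rfl⟩
    exact ⟨hint ha, mem_adjoin_of_finrank_prime (by rw [hK i]; exact Nat.prime_three) hyQ a⟩

end

end CubicOrbit

theorem mainTheorem5 {Ω : Type*} [Field Ω] [CharZero Ω]
    (R r : ℝ) (hR : 0 < R) (hr : 0 < r) (hr1 : r ≤ 1)
    (K : ℕ → Subfield Ω) [∀ i, NumberField (K i)] [∀ i, NumberField.IsTotallyReal (K i)]
    (hK : ∀ i, Module.finrank ℚ (K i) = 3)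
    (σ : ∀ i, Fin 3 ≃ (K i →+* ℝ))
    (M : ∀ i, CubicOrbit.FullModule (K i))
    (hM : Function.Injective fun i => (M i).order.map (K i).subtype)
    (Φ : ℕ → Fin 3 → Fin 3 → ℝ)
    (hΦ : ∀ i, CubicOrbit.IsTight (M i) (σ i) R r (Φ i)) :
    (∀ i, ∃! μ : MeasureTheory.Measure CubicOrbit.LatticeSpace,
      CubicOrbit.IsPeriodicMeasure ((M i).point (σ i)) μ) ∧
    ∀ μ : ℕ → MeasureTheory.Measure CubicOrbit.LatticeSpace,
      (∀ i, CubicOrbit.IsPeriodicMeasure ((M i).point (σ i)) (μ i)) →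
        CubicOrbit.EscapeOfMass (r ^ 2) μ := by
  refine ⟨fun i => (hΦ i).existsUnique_isPeriodicMeasure, fun μ hμ => ?_⟩
  have := fun i => (hμ i).isProbabilityMeasure
  refine CubicOrbit.escapeOfMass_of_cusp hr fun t ht htr δ hδ => ?_
  -- Since `t < r`, the exponent tends to `-∞`, so every depth `δ` is eventually reached.
  have h1 : Tendsto (fun i => 2 * R * Real.exp ((t - r) *
      CubicOrbit.ceilSet (CubicOrbit.hexVertices (Φ i)))) atTop (𝓝 (2 * R * 0)) :=
    (Real.tendsto_exp_atBot.comp ((CubicOrbit.tendsto_ceilSet K hK σ M hM Φ hΦ).const_mul_atTop_of_neg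
      (sub_neg.2 htr))).const_mul _
  rw [mul_zero] at h1
  filter_upwards [h1.eventually_le_const hδ] with i hi
  exact (hΦ i).le_measure_cusp hR ht (htr.trans_le hr1) hi (hμ i)
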